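/- \textbf{Setting.} Let $u,m\ge 1$, $n=u+m$, $\mathcal X\subseteq\mathbb R^{D}$, $\mathcal Y\subseteq\mathbb R$, and let $(x_i,y_i)_{i=1}^n$ be points of $\mathcal X\times\mathcal Y$ (the full sample). For $h:\mathcal X\times\mathcal Y\to\mathbb R$ write $h(i)=h(x_i,y_i)$, $\mathcal L_n(h)=\frac1n\sum_{i=1}^n h(i)$ and $T_n(h)=\frac1n\sum_{i=1}^n h(i)^2$. Let $\mathbf d=(d_1,\dots,d_u)$ have independent entries, $d_i$ uniform on $\{i,\dots,n\}$. The RANDPERM algorithm produces the vector $\mathbf Z_{\mathbf d}$ from $\mathbf d$: start with the array $I=(1,\dots,n)$ and, for $i=1,\dots,u$, put $\mathbf Z_{\mathbf d}(i)=I(d_i)$ and then swap the values $I(i)$ and $I(d_i)$; so $\mathbf Z_{\mathbf d}$ lists $u$ indices sampled uniformly without replacement from $\{1,\dots,n\}$. Let $\{\mathbf Z_{\mathbf d}\}$ be the set of test indices, $\overline{\mathbf Z_{\mathbf d}}$ its complement (the training indices), and $$\mathcal U^{(u)}_h(\mathbf Z_{\mathbf d})=\frac1u\sum_{i\in\{\mathbf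 Z_{\mathbf d}\}}h(i),\qquad \mathcal L^{(m)}_h(\overline{\mathbf Z_{\mathbf d}})=\frac1m\sum_{i\in\overline{\mathbf Z_{\mathbf d}}}h(i),$$ $$R^+_{u,\mathbf d}h=\mathcal U^{(u)}_h(\mathbf Z_{\mathbf d})-\mathcal L_n(h),\qquad R^+_{m,\mathbf d}h=\mathcal L^{(m)}_h(\overline{\mathbf Z_{\mathbf d}})-\mathcal L_n(h),\qquad R^-_{m,\mathbf d}h=-R^+_{m,\mathbf d}h .$$ Let $\ell:\mathbb R\times\mathcal Y\to\mathbb R$ be a loss function, $\mathcal F$ a class of functions $f:\mathcal X\to\mathbb R$, $\ell_f(x,y)=\ell(f(x),y)$, and $\Delta_{\mathcal F}=\{\ell_{f_1}-\ell_{f_2}: f_1,f_2\in\mathcal F\}$. Assume $0\le \ell_f(i)\le L_0$ for all $f\in\mathcal F$ and $1\le i\le n$, where $L_0\ge 2\sqrt2$. \textbf{Main Assumption.} (1) There is $f_n^*\in\mathcal F$ with $\mathcal L_n(\ell_{f_n^*})=\inf_{f\in\mathcal F}\mathcal L_n(\ell_f)$. (2) There is a constant $B$ such that $T_n(\ell_f-\ell_{f_n^*})\le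 B\,\mathcal L_n(\ell_f-\ell_{f_n^*})$ for all $f\in\mathcal F$. A function $\psi:[0,\infty)\to[0,\infty)$ is \emph{sub-root} if it is nondecreasing and $r\mapsto\psi(r)/\sqrt r$ is nonincreasing on $(0,\infty)$. Its \emph{fixed point} is the largest $r\ge0$ with $\psi(r)=r$; this is the unique positive solution of $\psi(r)=r$ unless $\psi\equiv0$. \textbf{Theorem.} Fix $K>1$. There are a constant $c_0>0$ depending only on $K$ and a constant $c_1>0$ depending only on $K$ and $L_0$ such that the following holds in every such setting satisfying the Main Assumption. For $h\in\Delta_{\mathcal F}$ let $$\tilde T_n(h)=\inf_{f_1,f_2\in\mathcal F:\ \ell_{f_1}-\ell_{f_2}=h}\Bigl(2B\,\mathcal L_n(\ell_{f_1}-\ell_{f_n^*})+2B\,\mathcal L_n(\ell_{f_2}-\ell_{f_n^*})\Bigr).$$ Let $\psi_u,\psi_m$ be sub-root functions with fixed points $r_u,r_m$, such that for all $r\ge r_u$ $$\psi_u(r)\ge\max\Bigl\{\mathbb E_{\mathbf d}\Bigl[\sup_{h\in\Delta_{\mathcal F},\,\tilde T_n(h)\le r}R^+_{u,\mathbf d}h\Bigr],\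 \mathbb E_{\mathbf d}\Bigl[\sup_{h\in\Delta_{\mathcal F},\,\tilde T_n(h)\le r}R^+_{u,\mathbf d}h^2\Bigr]\Bigr\},$$ and for all $r\ge r_m$ $$\psi_m(r)\ge\max\Bigl\{\mathbb E_{\mathbf d}\Bigl[\sup_{h\in\Delta_{\mathcal F},\,\tilde T_n(h)\le r}R^-_{m,\mathbf d}h\Bigr],\ \mathbb E_{\mathbf d}\Bigl[\sup_{h\in\Delta_{\mathcal F},\,\tilde T_n(h)\le r}R^+_{m,\mathbf d}h^2\Bigr]\Bigr\}.$$ Then for every $x>0$, with probability at least $1-e^{-x}$ over $\mathbf d$, simultaneously for all $h\in\Delta_{\mathcal F}$ and all $f_1,f_2\in\mathcal F$ with $h=\ell_{f_1}-\ell_{f_2}$, $$\mathcal U^{(u)}_h(\mathbf Z_{\mathbf d})\le\mathcal L^{(m)}_h(\overline{\mathbf Z_{\mathbf d}})+\frac{2B}{K}\Bigl(\mathcal L_n(\ell_{f_1}-\ell_{f_n^*})+\mathcal L_n(\ell_{f_2}-\ell_{f_n^*})\Bigr)+c_0(r_u+r_m)+\frac{c_1x}{\min\{m,u\}}.$$ 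-/

import Mathlib

open MeasureTheory ProbabilityTheory

namespace TLC

noncomputable section

/-! ### Sampling without replacement by the RANDPERM algorithm -/

/-- The law of the random vector `d = (d_1, …, d_u)` whose entries are independent, the `i`-th one
being uniform on the positions `i, i + 1, …, n`, where `n = u + m` (positions are numbered from `0`
here). -/
def drawLaw (u m : ℕ) : Measure (Fin u → Fin (u + m)) :=
  Measure.pi fun i : Fin u => uniformOn (Set.Ici (Fin.castAdd m i))

/-- The array `I` after `k` rounds of RANDPERM: it starts as the identity, and round `i` swaps the
values of `I(i)` and `I(d_i)`. -/
def permArray {u m : ℕ} (d : Fin u → Fin (u + m)) : ℕ → Equiv.Perm (Fin (u + m))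
  | 0 => 1
  | k + 1 =>
    if hk : k < u then
      permArray d k * Equiv.swap (Fin.castAdd m ⟨k, hk⟩) (d ⟨k, hk⟩)
    else permArray d k

/-- The output vector `Z_d` of RANDPERM: round `i` sets `Z_d(i) = I(d_i)` before the swap. -/
def drawnIndex {u m : ℕ} (d : Fin u → Fin (u + m)) (i : Fin u) : Fin (u + m) :=
  permArray d i (d i)

/-- The index set `{Z_d}` of the test points. -/
def testSet {u m : ℕ} (d : Fin u → Fin (u + m)) : Finset (Fin (u + m)) :=
  Finset.univ.image (drawnIndex d)

/-- The index set of the training points, the complement of `{Z_d}`. -/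
def trainSet {u m : ℕ} (d : Fin u → Fin (u + m)) : Finset (Fin (u + m)) :=
  (testSet d)ᶜ

/-! ### Losses; `S` is the full sample, a family of `n` labelled points, and `h(i) = h (S i)` -/

/-- The average `L_n(h)` of `h` over the full sample. -/
def avgLoss {α : Type*} {n : ℕ} (S : Fin n → α) (h : α → ℝ) : ℝ :=
  1 / (n : ℝ) * ∑ i, h (S i)

/-- The average `T_n(h)` of the square of `h` over the full sample. -/
def avgSqLoss {α : Type*} {n : ℕ} (S : Fin n → α) (h : α → ℝ) : ℝ :=
  1 / (n : ℝ) * ∑ i, h (S i) ^ 2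

/-- The test loss `U_h^{(u)}(Z_d)`. -/
def testLoss {α : Type*} {u m : ℕ} (S : Fin (u + m) → α) (d : Fin u → Fin (u + m))
    (h : α → ℝ) : ℝ :=
  1 / (u : ℝ) * ∑ i ∈ testSet d, h (S i)

/-- The training loss `L_h^{(m)}`, on the complement of `{Z_d}`. -/
def trainLoss {α : Type*} {u m : ℕ} (S : Fin (u + m) → α) (d : Fin u → Fin (u + m))
    (h : α → ℝ) : ℝ :=
  1 / (m : ℝ) * ∑ i ∈ trainSet d, h (S i)

/-- `R^+_{u,d} h`. -/
def testDev {α : Type*} {u m : ℕ} (S : Fin (u + m) → α) (d : Fin u → Fin (u + m))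
    (h : α → ℝ) : ℝ :=
  1 / (u : ℝ) * ∑ i : Fin u, h (S (drawnIndex d i)) - avgLoss S h

/-- `R^+_{m,d} h`; the quantity `R^-_{m,d} h` is its negative. -/
def trainDev {α : Type*} {u m : ℕ} (S : Fin (u + m) → α) (d : Fin u → Fin (u + m))
    (h : α → ℝ) : ℝ :=
  trainLoss S d h - avgLoss S h

/-- `E_d [ sup_{h ∈ H} Φ(d, h) ]`. -/
def expSup {β : Type*} (u m : ℕ) (H : Set β) (Φ : (Fin u → Fin (u + m)) → β → ℝ) : ℝ :=
  ∫ d, (⨆ h : H, Φ d h) ∂(drawLaw u m)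

/-! ### Sub-root functions -/

/-- Sub-root functions on `[0, ∞)`; values at negative arguments are irrelevant. -/
structure IsSubRoot (ψ : ℝ → ℝ) : Prop where
  nonneg : ∀ r, 0 ≤ r → 0 ≤ ψ r
  mono : MonotoneOn ψ (Set.Ici 0)
  anti : AntitoneOn (fun r => ψ r / Real.sqrt r) (Set.Ioi 0)

/-- The fixed point of a sub-root function: its largest fixed point on `[0, ∞)`. If `ψ` is not
identically zero, this is the unique positive solution of `ψ r = r` (the point `0`, which may
solve the equation too, is not meant then). -/
def IsFixedPointOf (ψ : ℝ → ℝ) (r : ℝ) : Prop :=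
  IsGreatest {s : ℝ | 0 ≤ s ∧ ψ s = s} r

/-! ### Loss classes; `F` is the class of prediction functions -/

/-- The loss function `ℓ_f (x, y) = ℓ(f(x), y)` of a prediction function `f`. -/
def lossFun {X Y : Type*} (ℓ : ℝ → Y → ℝ) (f : X → ℝ) : X × Y → ℝ :=
  fun p => ℓ (f p.1) p.2

/-- The class `Δ_F` of differences `ℓ_{f₁} - ℓ_{f₂}` with `f₁, f₂ ∈ F`. -/
def lossDiffClass {X Y : Type*} (ℓ : ℝ → Y → ℝ) (F : Set (X → ℝ)) : Set (X × Y → ℝ) :=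
  {h | ∃ f₁ ∈ F, ∃ f₂ ∈ F, h = lossFun ℓ f₁ - lossFun ℓ f₂}

/-- The Main Assumption, for the minimizer `fstar` and the constant `B`. -/
structure MainAssumption {X Y : Type*} {n : ℕ} (ℓ : ℝ → Y → ℝ) (F : Set (X → ℝ))
    (S : Fin n → X × Y) (fstar : X → ℝ) (B : ℝ) : Prop where
  mem : fstar ∈ F
  minimizes : ∀ f ∈ F, avgLoss S (lossFun ℓ fstar) ≤ avgLoss S (lossFun ℓ f)
  sq_le : ∀ f ∈ F, avgSqLoss S (lossFun ℓ f - lossFun ℓ fstar)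
    ≤ B * avgLoss S (lossFun ℓ f - lossFun ℓ fstar)

/-- The surrogate variance `T̃_n(h)`: the infimum of
`2B L_n(ℓ_{f₁} - ℓ_{f*}) + 2B L_n(ℓ_{f₂} - ℓ_{f*})` over the representations
`ℓ_{f₁} - ℓ_{f₂} = h` with `f₁, f₂ ∈ F`. -/
def surrogateVar {X Y : Type*} {n : ℕ} (ℓ : ℝ → Y → ℝ) (F : Set (X → ℝ))
    (S : Fin n → X × Y) (fstar : X → ℝ) (B : ℝ) (h : X × Y → ℝ) : ℝ :=
  sInf {t : ℝ | ∃ f₁ ∈ F, ∃ f₂ ∈ F, lossFun ℓ f₁ - lossFun ℓ f₂ = h ∧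
    t = 2 * B * avgLoss S (lossFun ℓ f₁ - lossFun ℓ fstar)
      + 2 * B * avgLoss S (lossFun ℓ f₂ - lossFun ℓ fstar)}

/-- The localized class `{h ∈ Δ_F : T̃_n(h) ≤ r}`. -/
def localClass {X Y : Type*} {n : ℕ} (ℓ : ℝ → Y → ℝ) (F : Set (X → ℝ))
    (S : Fin n → X × Y) (fstar : X → ℝ) (B : ℝ) (r : ℝ) : Set (X × Y → ℝ) :=
  {h | h ∈ lossDiffClass ℓ F ∧ surrogateVar ℓ F S fstar B h ≤ r}

end

end TLC

namespace TLC

open Finset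

/-! ### A modified logarithmic Sobolev inequality for uniform random subsets -/

/-! Write `U`, `L` and `L_n` for the averages of `h` over the test set, the training set and the
full sample. Since `u U + m L = n L_n`, the gap `U - L` equals `n/m` times `U - L_n` and also `n/u`
times `L_n - L`. For the smaller of the two sets the factor is at most 2, so a one-sided uniform
deviation bound for that set alone suffices. No union bound is needed, and the failure probability
stays `e^{-x}`. RANDPERM makes this set a uniform random `k`-subset, `k = min(u, m)`
(`integral_testSet`, `integral_trainSet`).

Concentration comes from the entropy method. The modified log-Sobolev inequality
`card_mul_sliceEnt_le` is proved by induction on the ground set, conditioning on whether a point `v`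
is chosen and averaging over `v`. Herbst's argument turns it into a sub-Gaussian upper tail for
functions with bounded squared decreases along exchanges. Applied to `√Z`, this gives a tail bound
for `Z` whose squared decreases are at most a multiple of `Z` (`card_gt_le_of_selfBounding`). A
supremum of deviations need not have that property, but it does after adding `θ` times the supremum
of the second moments on the random set, and `θ r`. The mean of the added supremum is controlled by
the hypothesis on `h²` (`card_exists_sliceDev_gt_le`).

For localization, each `h` is scaled by `r / max(r, T̃_n(h))`, which forces second moment at most
`r`. Peeling over the shells `T̃_n ≤ 4^i r` bounds the expected suprema of the scaled class by `8
ψ(r)`, and `ψ(r) ≤ √(a r)` above the fixed point `a`. With `r` a large multiple of `a` plus a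
multiple of `x/k`, the scaled deviations are at most `r/(2K)`. Undoing the scaling gives `(T̃_n(h) +
r)/(2K)`, and the factor 2 above turns this into the claim. -/

/-- The integrand `(x - y) (log x - log y)` of the entropic Dirichlet form. -/
noncomputable def logDiff (x y : ℝ) : ℝ := (x - y) * (Real.log x - Real.log y)

/-- The set `W` with its element `a` exchanged for `b`. -/
def exchange {α : Type*} [DecidableEq α] (W : Finset α) (a b : α) : Finset α :=
  insert b (W.erase a)

lemma logDiff_nonneg {x y : ℝ} (hx : 0 < x) (hy : 0 < y) : 0 ≤ logDiff x y := by
  unfold logDiff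
  rcases le_total x y with h | h
  · have := Real.log_le_log hx h
    nlinarith
  · have := Real.log_le_log hy h
    nlinarith

lemma logDiff_mul {c x y : ℝ} (hc : 0 < c) (hx : 0 < x) (hy : 0 < y) :
    logDiff (c * x) (c * y) = c * logDiff x y := by
  unfold logDiff
  rw [Real.log_mul hc.ne' hx.ne', Real.log_mul hc.ne' hy.ne']
  ring

/-- The log-sum inequality. -/
lemma log_sum_inequality {ι : Type*} (s : Finset ι) (x y : ι → ℝ) (hx : ∀ i, 0 < x i)
    (hy : ∀ i, 0 < y i) :
    (∑ i ∈ s, x i) * (Real.log (∑ i ∈ s, x i) - Real.log (∑ i ∈ s, y i))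
      ≤ ∑ i ∈ s, x i * (Real.log (x i) - Real.log (y i)) := by
  rcases s.eq_empty_or_nonempty with rfl | hs
  · simp
  set X := ∑ i ∈ s, x i with hX
  set Y := ∑ i ∈ s, y i with hY
  have hXp : 0 < X := Finset.sum_pos (fun i _ => hx i) hs
  have hYp : 0 < Y := Finset.sum_pos (fun i _ => hy i) hs
  -- This is `1 - 1/t ≤ log t` at `t = x_i Y / (y_i X)`. The correction terms sum to `X - Y (X/Y) =
  -- 0`.
  have key : ∀ i ∈ s, x i * (Real.log X - Real.log Y) + x i - y i * (X / Y)
      ≤ x i * (Real.log (x i) - Real.log (y i)) := by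
    intro i _
    have h := Real.one_sub_inv_le_log_of_pos
      (show 0 < (x i * Y) / (y i * X) from
        div_pos (mul_pos (hx i) hYp) (mul_pos (hy i) hXp))
    rw [Real.log_div (mul_pos (hx i) hYp).ne' (mul_pos (hy i) hXp).ne',
      Real.log_mul (hx i).ne' hYp.ne', Real.log_mul (hy i).ne' hXp.ne'] at h
    have h2 := mul_le_mul_of_nonneg_left h (hx i).le
    have h3 : x i * (1 - (x i * Y / (y i * X))⁻¹) = x i - y i * (X / Y) := by
      have := hx i
      field_simp
    linarith
  have := Finset.sum_le_sum key
  rw [Finset.sum_sub_distrib, Finset.sum_add_distrib, ← Finset.sum_mul, ← Finset.sum_mul,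
    ← hX, ← hY] at this
  have h4 : Y * (X / Y) = X := by field_simp
  linarith

lemma logDiff_sum_le {ι : Type*} (s : Finset ι) (x y : ι → ℝ) (hx : ∀ i, 0 < x i)
    (hy : ∀ i, 0 < y i) :
    logDiff (∑ i ∈ s, x i) (∑ i ∈ s, y i) ≤ ∑ i ∈ s, logDiff (x i) (y i) := by
  have h1 := log_sum_inequality s x y hx hy
  have h2 := log_sum_inequality s y x hy hx
  have h3 : ∑ i ∈ s, logDiff (x i) (y i)
      = ∑ i ∈ s, x i * (Real.log (x i) - Real.log (y i))
        + ∑ i ∈ s, y i * (Real.log (y i) - Real.log (x i)) := by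
    rw [← Finset.sum_add_distrib]
    refine Finset.sum_congr rfl fun i _ => ?_
    unfold logDiff; ring
  rw [h3]
  unfold logDiff
  linarith

/-- Concavity bounds the logarithm of the mean below by the mean of the logarithms. After this
replacement the left side equals the right side exactly. -/
lemma entropy_two_point {p q x y : ℝ} (hp : 0 < p) (hq : 0 < q) (hx : 0 < x) (hy : 0 < y) :
    p * x * Real.log x + q * y * Real.log y
        - (p * x + q * y) * Real.log ((p * x + q * y) / (p + q))
      ≤ p * q / (p + q) * logDiff x y := by
  have hpq : 0 < p + q := add_pos hp hq
  have hc := strictConcaveOn_log_Ioi.concaveOn.2 (Set.mem_Ioi.2 hx) (Set.mem_Ioi.2 hy)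
    (div_pos hp hpq).le (div_pos hq hpq).le (by field_simp)
  simp only [smul_eq_mul] at hc
  have e : p / (p + q) * x + q / (p + q) * y = (p * x + q * y) / (p + q) := by field_simp
  rw [e] at hc
  have h2 := mul_le_mul_of_nonneg_left hc (show 0 ≤ p * x + q * y by positivity)
  have h3 : p * x * Real.log x + q * y * Real.log y - (p * x + q * y) *
      (p / (p + q) * Real.log x + q / (p + q) * Real.log y) = p * q / (p + q) * logDiff x y := by
    unfold logDiff; field_simp; ring
  linarith

/-! ### Entropy and exchange Dirichlet form on `k`-subsets. -/

section Slice

variable {α : Type*}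

/-- The entropy, summed rather than averaged, of `f` on the `k`-subsets of `s`. -/
noncomputable def sliceEnt (s : Finset α) (k : ℕ) (f : Finset α → ℝ) : ℝ :=
  ∑ W ∈ s.powersetCard k, f W * Real.log (f W)
    - (∑ W ∈ s.powersetCard k, f W)
      * Real.log ((∑ W ∈ s.powersetCard k, f W) / (s.card.choose k : ℝ))

lemma sliceEnt_eq_zero {s : Finset α} {k : ℕ} (hk : k = 0 ∨ s.card ≤ k) (f : Finset α → ℝ) :
    sliceEnt s k f = 0 := by
  unfold sliceEnt
  rcases hk with rfl | hk
  · simp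
  · rcases hk.eq_or_lt with h | h
    · subst h
      simp [Finset.powersetCard_self]
    · simp [Finset.powersetCard_eq_empty.2 h]

variable [DecidableEq α]

lemma sum_powersetCard_split {s : Finset α} {v : α} (hv : v ∈ s) (k : ℕ) (g : Finset α → ℝ) :
    ∑ W ∈ s.powersetCard (k + 1), g W
      = ∑ W ∈ (s.erase v).powersetCard k, g (insert v W)
        + ∑ W ∈ (s.erase v).powersetCard (k + 1), g W := by
  conv_lhs => rw [← Finset.insert_erase hv]
  rw [Finset.powersetCard_succ_insert (Finset.notMem_erase v s), Finset.sum_union, add_comm]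
  · congr 1
    rw [Finset.sum_image]
    intro A hA B hB hAB
    have hA' : v ∉ A := fun h => Finset.notMem_erase v s ((Finset.mem_powersetCard.1 hA).1 h)
    have hB' : v ∉ B := fun h => Finset.notMem_erase v s ((Finset.mem_powersetCard.1 hB).1 h)
    rw [← Finset.erase_insert hA', ← Finset.erase_insert hB', hAB]
  · rw [Finset.disjoint_left]
    intro A hA hA'
    obtain ⟨B, -, rfl⟩ := Finset.mem_image.1 hA'
    exact Finset.notMem_erase v s ((Finset.mem_powersetCard.1 hA).1 (Finset.mem_insert_self v B))

/-- Double counting of the pairs `b ∈ V` with `V` of size `k + 1`, where `W = V \ {b}`. -/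
lemma sum_powersetCard_insert (t : Finset α) (k : ℕ) (g : Finset α → ℝ) :
    ∑ W ∈ t.powersetCard k, ∑ b ∈ t \ W, g (insert b W)
      = (k + 1) * ∑ V ∈ t.powersetCard (k + 1), g V := by
  have h : ∑ V ∈ t.powersetCard (k + 1), ∑ _b ∈ V, g V
      = (k + 1) * ∑ V ∈ t.powersetCard (k + 1), g V := by
    rw [Finset.mul_sum]
    refine Finset.sum_congr rfl fun V hV => ?_
    rw [Finset.sum_const, (Finset.mem_powersetCard.1 hV).2, nsmul_eq_mul]
    push_cast; ring
  rw [← h, Finset.sum_sigma', Finset.sum_sigma']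
  refine Finset.sum_bij' (fun p _ => ⟨insert p.2 p.1, p.2⟩) (fun p _ => ⟨p.1.erase p.2, p.2⟩)
    ?_ ?_ ?_ ?_ ?_
  · rintro ⟨W, b⟩ h
    simp only [Finset.mem_sigma, Finset.mem_powersetCard, Finset.mem_sdiff] at h ⊢
    refine ⟨⟨Finset.insert_subset h.2.1 h.1.1, ?_⟩, Finset.mem_insert_self _ _⟩
    rw [Finset.card_insert_of_notMem h.2.2, h.1.2]
  · rintro ⟨V, b⟩ h
    simp only [Finset.mem_sigma, Finset.mem_powersetCard, Finset.mem_sdiff] at h ⊢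
    refine ⟨⟨(Finset.erase_subset _ _).trans h.1.1, ?_⟩, h.1.1 h.2, Finset.notMem_erase _ _⟩
    rw [Finset.card_erase_of_mem h.2, h.1.2]; rfl
  · rintro ⟨W, b⟩ h
    simp only [Finset.mem_sigma, Finset.mem_powersetCard, Finset.mem_sdiff] at h
    simp [Finset.erase_insert h.2.2]
  · rintro ⟨V, b⟩ h
    simp only [Finset.mem_sigma, Finset.mem_powersetCard] at h
    simp [Finset.insert_erase h.2]
  · rintro ⟨W, b⟩ _
    rfl

/-- Chain rule for entropy, conditioning on whether `v` is chosen. What remains is the entropy of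
the two conditional means, bounded by `entropy_two_point` and then distributed over exchanges of `v`
by the log-sum inequality. -/
lemma sliceEnt_split_le {s : Finset α} {v : α} (hv : v ∈ s) {k : ℕ} (hk : k + 1 < s.card)
    {f : Finset α → ℝ} (hf : ∀ W, 0 < f W) :
    sliceEnt s (k + 1) f ≤ sliceEnt (s.erase v) k (fun W => f (insert v W))
      + sliceEnt (s.erase v) (k + 1) f
      + 1 / (s.card : ℝ) * ∑ W ∈ (s.erase v).powersetCard k, ∑ b ∈ s.erase v \ W,
          logDiff (f (insert v W)) (f (insert b W)) := by
  set t := s.erase v with ht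
  obtain ⟨n, hn⟩ : ∃ n, s.card = n + 1 := ⟨s.card - 1, by omega⟩
  have htc : t.card = n := by rw [ht, Finset.card_erase_of_mem hv, hn]; rfl
  have hkn : k + 1 ≤ n := by omega
  unfold sliceEnt
  rw [sum_powersetCard_split hv k f, sum_powersetCard_split hv k (fun W => f W * Real.log (f W)),
    ← ht, htc, hn]
  set S1 := ∑ W ∈ t.powersetCard k, f (insert v W) with hS1
  set S0 := ∑ W ∈ t.powersetCard (k + 1), f W with hS0
  have hS1p : 0 < S1 := Finset.sum_pos (fun W _ => hf _)
    (Finset.powersetCard_nonempty.2 (by omega))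
  have hS0p : 0 < S0 := Finset.sum_pos (fun W _ => hf _)
    (Finset.powersetCard_nonempty.2 (by omega))
  have hN1 : (0 : ℝ) < (n.choose k : ℝ) := by exact_mod_cast Nat.choose_pos (by omega)
  have hN0 : (0 : ℝ) < (n.choose (k + 1) : ℝ) := by exact_mod_cast Nat.choose_pos hkn
  have hN : ((n + 1).choose (k + 1) : ℝ) = (n.choose k : ℝ) + (n.choose (k + 1) : ℝ) := by
    exact_mod_cast Nat.choose_succ_succ n k
  have hrel : (n.choose (k + 1) : ℝ) * (k + 1) = (n.choose k : ℝ) * ((n : ℝ) - k) := by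
    have := Nat.choose_succ_right_eq n k
    have h2 : ((n - k : ℕ) : ℝ) = (n : ℝ) - k := Nat.cast_sub (by omega)
    rw [← h2]; exact_mod_cast this
  have hnk : (0 : ℝ) < (n : ℝ) - k := by
    have : (k : ℝ) + 1 ≤ n := by exact_mod_cast hkn
    linarith
  have h2p := entropy_two_point hN1 hN0 (div_pos hS1p hN1) (div_pos hS0p hN0)
  rw [mul_div_cancel₀ _ hN1.ne', mul_div_cancel₀ _ hN0.ne', ← hN] at h2p
  -- Both multiples are sums over the same pairs `(W, b)` with `b ∉ W`: each `W` has `n - k` such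
  -- `b`, and each `(k+1)`-set arises from `k + 1` pairs.
  have hsum : logDiff (((n : ℝ) - k) * S1) ((k + 1) * S0)
      ≤ ∑ W ∈ t.powersetCard k, ∑ b ∈ t \ W, logDiff (f (insert v W)) (f (insert b W)) := by
    have e1 : ((n : ℝ) - k) * S1 = ∑ p ∈ (t.powersetCard k).sigma (fun W => t \ W),
        f (insert v p.1) := by
      rw [Finset.sum_sigma, hS1, Finset.mul_sum]
      refine Finset.sum_congr rfl fun W hW => ?_
      have hW' := Finset.mem_powersetCard.1 hW
      change _ = ∑ _b ∈ t \ W, f (insert v W)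
      rw [Finset.sum_const, Finset.card_sdiff_of_subset hW'.1, hW'.2, htc, nsmul_eq_mul,
        Nat.cast_sub (by omega)]
    have e2 : ((k : ℝ) + 1) * S0 = ∑ p ∈ (t.powersetCard k).sigma (fun W => t \ W),
        f (insert p.2 p.1) := by
      rw [Finset.sum_sigma, sum_powersetCard_insert]
    rw [e1, e2, Finset.sum_sigma']
    exact logDiff_sum_le _ _ _ (fun _ => hf _) (fun _ => hf _)
  -- Homogeneity of `logDiff`: the common factor is `C(n,k) (n - k) = C(n,k+1) (k + 1)`, and the
  -- binomials collapse to `1/(n + 1)`.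
  have hscale : (n.choose k : ℝ) * (n.choose (k + 1) : ℝ) / ((n + 1).choose (k + 1) : ℝ)
      * logDiff (S1 / (n.choose k : ℝ)) (S0 / (n.choose (k + 1) : ℝ))
      = 1 / ((n + 1 : ℕ) : ℝ) * logDiff (((n : ℝ) - k) * S1) ((k + 1) * S0) := by
    have hM : 0 < (n.choose k : ℝ) * ((n : ℝ) - k) := mul_pos hN1 hnk
    have e1 : ((n : ℝ) - k) * S1
        = ((n.choose k : ℝ) * ((n : ℝ) - k)) * (S1 / (n.choose k : ℝ)) := by field_simp
    have e2 : ((k : ℝ) + 1) * S0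
        = ((n.choose k : ℝ) * ((n : ℝ) - k)) * (S0 / (n.choose (k + 1) : ℝ)) := by
      rw [← hrel]; field_simp
    rw [e1, e2, logDiff_mul hM (div_pos hS1p hN1) (div_pos hS0p hN0), ← mul_assoc]
    congr 1
    rw [hN]
    push_cast
    have h1 : (n.choose (k + 1) : ℝ) * (n + 1)
        = ((n.choose k : ℝ) + (n.choose (k + 1) : ℝ)) * ((n : ℝ) - k) := by
      linear_combination hrel
    have : (0 : ℝ) < (n : ℝ) + 1 := by positivity
    field_simp
    linear_combination h1
  have hlast : 1 / ((n + 1 : ℕ) : ℝ) * logDiff (((n : ℝ) - k) * S1) ((k + 1) * S0)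
      ≤ 1 / ((n + 1 : ℕ) : ℝ) * ∑ W ∈ t.powersetCard k, ∑ b ∈ t \ W,
          logDiff (f (insert v W)) (f (insert b W)) :=
    mul_le_mul_of_nonneg_left hsum (by positivity)
  rw [hscale] at h2p
  linarith

/-- The entropic Dirichlet form of the exchange walk on `k`-subsets of `s`. -/
noncomputable def sliceDir (s : Finset α) (k : ℕ) (f : Finset α → ℝ) : ℝ :=
  ∑ W ∈ s.powersetCard k, ∑ a ∈ W, ∑ b ∈ s \ W, logDiff (f W) (f (exchange W a b))

lemma sliceDir_nonneg (s : Finset α) (k : ℕ) {f : Finset α → ℝ} (hf : ∀ W, 0 < f W) :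
    0 ≤ sliceDir s k f :=
  Finset.sum_nonneg fun _ _ => Finset.sum_nonneg fun _ _ => Finset.sum_nonneg fun _ _ =>
    logDiff_nonneg (hf _) (hf _)

/-- An exchange not moving `v` either keeps it inside the set or keeps it outside; these are the
exchanges of the two conditional slices. -/
lemma sliceDir_erase {s : Finset α} {v : α} (hv : v ∈ s) (k : ℕ) (f : Finset α → ℝ) :
    sliceDir (s.erase v) k (fun W => f (insert v W)) + sliceDir (s.erase v) (k + 1) f
      = ∑ W ∈ s.powersetCard (k + 1), ∑ a ∈ W, ∑ b ∈ s \ W,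
          if v = a ∨ v = b then 0 else logDiff (f W) (f (exchange W a b)) := by
  rw [sum_powersetCard_split hv]
  unfold sliceDir
  congr 1
  · refine Finset.sum_congr rfl fun W hW => ?_
    have hW' := (Finset.mem_powersetCard.1 hW).1
    have hvW : v ∉ W := fun h => Finset.notMem_erase v s (hW' h)
    rw [Finset.sum_insert hvW]
    have hset : s \ insert v W = s.erase v \ W := by
      ext b; simp only [Finset.mem_sdiff, Finset.mem_insert, Finset.mem_erase]; tauto
    simp only [true_or, if_true, Finset.sum_const_zero, zero_add]
    rw [hset]
    refine Finset.sum_congr rfl fun a ha => Finset.sum_congr rfl fun b hb => ?_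
    have hva : v ≠ a := fun h => hvW (h ▸ ha)
    have hvb : v ≠ b := fun h => by
      rw [← h] at hb; simp at hb
    rw [if_neg (by tauto)]
    congr 2
    unfold exchange
    rw [Finset.erase_insert_of_ne hva, Finset.insert_comm]
  · refine Finset.sum_congr rfl fun W hW => ?_
    have hW' := (Finset.mem_powersetCard.1 hW).1
    have hvW : v ∉ W := fun h => Finset.notMem_erase v s (hW' h)
    refine Finset.sum_congr rfl fun a ha => ?_
    have hva : v ≠ a := fun h => hvW (h ▸ ha)
    have hset : s \ W = insert v (s.erase v \ W) := by
      ext b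
      simp only [Finset.mem_sdiff, Finset.mem_insert, Finset.mem_erase]
      by_cases hb : b = v
      · subst hb; tauto
      · tauto
    rw [hset, Finset.sum_insert (by simp)]
    simp only [or_true, if_true, zero_add]
    refine Finset.sum_congr rfl fun b hb => ?_
    have hvb : v ≠ b := fun h => by
      rw [← h] at hb; simp at hb
    rw [if_neg (by tauto)]

/-- The cross term of the chain rule consists of the exchanges that remove `v`. -/
lemma sum_logDiff_insert {s : Finset α} {v : α} (hv : v ∈ s) (k : ℕ) (f : Finset α → ℝ) :
    ∑ W ∈ (s.erase v).powersetCard k, ∑ b ∈ s.erase v \ W,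
        logDiff (f (insert v W)) (f (insert b W))
      = ∑ W ∈ s.powersetCard (k + 1), ∑ a ∈ W, ∑ b ∈ s \ W,
          if v = a then logDiff (f W) (f (exchange W a b)) else 0 := by
  rw [sum_powersetCard_split hv]
  have h0 : ∑ W ∈ (s.erase v).powersetCard (k + 1), ∑ a ∈ W, ∑ b ∈ s \ W,
      (if v = a then logDiff (f W) (f (exchange W a b)) else 0) = 0 := by
    refine Finset.sum_eq_zero fun W hW => Finset.sum_eq_zero fun a ha =>
      Finset.sum_eq_zero fun b _ => ?_
    have hW' := (Finset.mem_powersetCard.1 hW).1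
    rw [if_neg]
    rintro rfl
    exact Finset.notMem_erase v s (hW' ha)
  rw [h0, add_zero]
  refine Finset.sum_congr rfl fun W hW => ?_
  have hW' := (Finset.mem_powersetCard.1 hW).1
  have hvW : v ∉ W := fun h => Finset.notMem_erase v s (hW' h)
  have hset : s \ insert v W = s.erase v \ W := by
    ext b; simp only [Finset.mem_sdiff, Finset.mem_insert, Finset.mem_erase]; tauto
  rw [Finset.sum_insert hvW, hset]
  have h1 : ∑ a ∈ W, ∑ b ∈ s.erase v \ W,
      (if v = a then logDiff (f (insert v W)) (f (exchange (insert v W) a b)) else 0) = 0 := by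
    refine Finset.sum_eq_zero fun a ha => Finset.sum_eq_zero fun b _ => ?_
    rw [if_neg]
    rintro rfl
    exact hvW ha
  rw [h1, add_zero]
  refine Finset.sum_congr rfl fun b _ => ?_
  rw [if_pos rfl]
  unfold exchange
  rw [Finset.erase_insert hvW]

/-- The modified logarithmic Sobolev inequality for a uniform random `k`-subset. -/
theorem card_mul_sliceEnt_le (s : Finset α) (k : ℕ) {f : Finset α → ℝ} (hf : ∀ W, 0 < f W) :
    (s.card : ℝ) * sliceEnt s k f ≤ sliceDir s k f := by
  obtain ⟨n, hn⟩ : ∃ n, s.card = n := ⟨_, rfl⟩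
  induction n generalizing s k f with
  | zero =>
    rw [hn]; simpa using sliceDir_nonneg s k hf
  | succ n ih =>
    by_cases hk : k = 0 ∨ s.card ≤ k
    · rw [sliceEnt_eq_zero hk, mul_zero]
      exact sliceDir_nonneg s k hf
    push Not at hk
    obtain ⟨k, rfl⟩ : ∃ j, k = j + 1 := ⟨k - 1, by omega⟩
    have hn1 : 1 ≤ n := by omega
    have hnpos : (0 : ℝ) < n := by exact_mod_cast hn1
    set D := sliceDir s (k + 1) f with hD
    have hD0 : 0 ≤ D := sliceDir_nonneg s (k + 1) hf
    have step : ∀ v ∈ s, sliceEnt s (k + 1) f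
        ≤ 1 / (n : ℝ) * (∑ W ∈ s.powersetCard (k + 1), ∑ a ∈ W, ∑ b ∈ s \ W,
            if v = a ∨ v = b then 0 else logDiff (f W) (f (exchange W a b)))
          + 1 / ((n : ℝ) + 1) * (∑ W ∈ s.powersetCard (k + 1), ∑ a ∈ W, ∑ b ∈ s \ W,
            if v = a then logDiff (f W) (f (exchange W a b)) else 0) := by
      intro v hv
      have hc : (s.erase v).card = n := by rw [Finset.card_erase_of_mem hv, hn]; rfl
      have h1 := ih (s.erase v) k (f := fun W => f (insert v W)) (fun _ => hf _) hc
      have h2 := ih (s.erase v) (k + 1) hf hc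
      have h3 := sliceEnt_split_le hv hk.2 hf
      rw [sum_logDiff_insert hv, hn] at h3
      rw [← sliceDir_erase hv]
      rw [hc] at h1 h2
      have h4 : sliceEnt (s.erase v) k (fun W => f (insert v W))
          + sliceEnt (s.erase v) (k + 1) f ≤ 1 / (n : ℝ) *
          (sliceDir (s.erase v) k (fun W => f (insert v W))
            + sliceDir (s.erase v) (k + 1) f) := by
        rw [one_div, ← div_eq_inv_mul, le_div_iff₀ hnpos]
        linarith
      push_cast at h3
      linarith
    -- Summing over `v` in the `n + 1` points: an exchange `(a, b)` avoids `v` for `n - 1` choices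
    -- and removes `v` for one. The total coefficient `(n-1)/n + 1/(n+1)` is at most 1.
    have hsum := Finset.sum_le_sum step
    rw [Finset.sum_const, hn, nsmul_eq_mul, Finset.sum_add_distrib, ← Finset.mul_sum,
      ← Finset.mul_sum] at hsum
    have swap : ∀ c : α → α → α → ℝ → ℝ,
        ∑ v ∈ s, ∑ W ∈ s.powersetCard (k + 1), ∑ a ∈ W, ∑ b ∈ s \ W,
          c v a b (logDiff (f W) (f (exchange W a b)))
        = ∑ W ∈ s.powersetCard (k + 1), ∑ a ∈ W, ∑ b ∈ s \ W, ∑ v ∈ s,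
          c v a b (logDiff (f W) (f (exchange W a b))) := by
      intro c
      rw [Finset.sum_comm]
      refine Finset.sum_congr rfl fun W _ => ?_
      rw [Finset.sum_comm]
      refine Finset.sum_congr rfl fun a _ => ?_
      rw [Finset.sum_comm]
    have e1 := swap (fun v a b x => if v = a ∨ v = b then 0 else x)
    have e2 := swap (fun v a b x => if v = a then x else 0)
    rw [e1, e2] at hsum
    have f1 : ∑ W ∈ s.powersetCard (k + 1), ∑ a ∈ W, ∑ b ∈ s \ W, ∑ v ∈ s,
        (if v = a ∨ v = b then 0 else logDiff (f W) (f (exchange W a b)))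
        = ((n : ℝ) - 1) * D := by
      rw [hD, sliceDir, Finset.mul_sum]
      refine Finset.sum_congr rfl fun W hW => ?_
      rw [Finset.mul_sum]
      refine Finset.sum_congr rfl fun a ha => ?_
      rw [Finset.mul_sum]
      refine Finset.sum_congr rfl fun b hb => ?_
      have has : a ∈ s := (Finset.mem_powersetCard.1 hW).1 ha
      have hbs := Finset.mem_sdiff.1 hb
      have hab : b ≠ a := fun h => hbs.2 (h ▸ ha)
      have hfil : (s.filter fun v => ¬ (v = a ∨ v = b)) = (s.erase a).erase b := by
        ext v; simp only [Finset.mem_filter, Finset.mem_erase]; tauto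
      rw [Finset.sum_ite, Finset.sum_const_zero, zero_add, Finset.sum_const, hfil,
        Finset.card_erase_of_mem (Finset.mem_erase.2 ⟨hab, hbs.1⟩),
        Finset.card_erase_of_mem has, hn, nsmul_eq_mul]
      congr 1
      rw [Nat.add_sub_cancel, Nat.cast_sub hn1, Nat.cast_one]
    have f2 : ∑ W ∈ s.powersetCard (k + 1), ∑ a ∈ W, ∑ b ∈ s \ W, ∑ v ∈ s,
        (if v = a then logDiff (f W) (f (exchange W a b)) else 0) = D := by
      rw [hD, sliceDir]
      refine Finset.sum_congr rfl fun W hW => Finset.sum_congr rfl fun a ha =>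
        Finset.sum_congr rfl fun b _ => ?_
      rw [Finset.sum_ite_eq' s a, if_pos ((Finset.mem_powersetCard.1 hW).1 ha)]
    rw [f1, f2] at hsum
    rw [hn]
    refine hsum.trans ?_
    have : 1 / (n : ℝ) * (((n : ℝ) - 1) * D) + 1 / ((n : ℝ) + 1) * D
        = D - (1 / (n : ℝ) - 1 / ((n : ℝ) + 1)) * D := by
      field_simp; ring
    rw [this]
    have h5 : 1 / ((n : ℝ) + 1) ≤ 1 / (n : ℝ) :=
      one_div_le_one_div_of_le hnpos (by linarith)
    nlinarith

end Slice

/-! ### Concentration for functions of a uniform random subset -/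

/-- Herbst's argument on a finite set. -/
lemma sum_exp_le_of_entropy {β : Type*} {P : Finset β} (hP : P.Nonempty) (Z : β → ℝ) {c : ℝ}
    (h : ∀ l : ℝ, 0 < l →
      ∑ w ∈ P, Real.exp (l * Z w) * (l * Z w)
        - (∑ w ∈ P, Real.exp (l * Z w)) * Real.log ((∑ w ∈ P, Real.exp (l * Z w)) / (#P : ℝ))
      ≤ c * l ^ 2 * ∑ w ∈ P, Real.exp (l * Z w)) {l : ℝ} (hl : 0 < l) :
    (∑ w ∈ P, Real.exp (l * Z w)) / (#P : ℝ)
      ≤ Real.exp (l * ((∑ w ∈ P, Z w) / (#P : ℝ)) + c * l ^ 2) := by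
  have hN : (0 : ℝ) < (#P : ℝ) := by exact_mod_cast hP.card_pos
  set F : ℝ → ℝ := fun l => (∑ w ∈ P, Real.exp (l * Z w)) / (#P : ℝ) with hF
  set F' : ℝ → ℝ := fun l => (∑ w ∈ P, Real.exp (l * Z w) * Z w) / (#P : ℝ) with hF'
  have hFpos : ∀ l, 0 < F l := fun l =>
    div_pos (Finset.sum_pos (fun _ _ => Real.exp_pos _) hP) hN
  have hd : ∀ l, HasDerivAt F (F' l) l := by
    intro l
    refine HasDerivAt.div_const (HasDerivAt.fun_sum fun w _ => ?_) _
    simpa using ((hasDerivAt_id l).mul_const (Z w)).exp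
  have hdlog : ∀ l, HasDerivAt (fun l => Real.log (F l)) (F' l / F l) l := fun l =>
    (hd l).log (hFpos l).ne'
  -- The entropy hypothesis says exactly that `G' ≤ 0`. As `l` decreases to 0, `G` tends to `(log
  -- F)'(0)`, the mean of `Z`, so `G` never exceeds that mean.
  set G : ℝ → ℝ := fun l => Real.log (F l) / l - c * l with hG
  have hdG : ∀ l, 0 < l →
      HasDerivAt G ((F' l / F l * l - Real.log (F l) * 1) / l ^ 2 - c * 1) l := by
    intro l hl
    exact ((hdlog l).div (hasDerivAt_id l) hl.ne').sub ((hasDerivAt_id l).const_mul c)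
  have hanti : AntitoneOn G (Set.Ioi 0) := by
    refine antitoneOn_of_deriv_nonpos (convex_Ioi 0) ?_ ?_ ?_
    · exact fun l hl => (hdG l hl).continuousAt.continuousWithinAt
    · intro l hl
      rw [interior_Ioi] at hl
      exact (hdG l hl).differentiableAt.differentiableWithinAt
    · intro l hl
      rw [interior_Ioi] at hl
      have hl' : 0 < l := hl
      rw [(hdG l hl).deriv]
      have h1 := h l hl'
      have e1 : ∑ w ∈ P, Real.exp (l * Z w) = #P * F l := by
        exact (mul_div_cancel₀ _ hN.ne').symm
      have e2 : ∑ w ∈ P, Real.exp (l * Z w) * (l * Z w) = #P * (l * F' l) := by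
        have : ∑ w ∈ P, Real.exp (l * Z w) * (l * Z w)
            = l * ∑ w ∈ P, Real.exp (l * Z w) * Z w := by
          rw [Finset.mul_sum]; exact Finset.sum_congr rfl fun _ _ => by ring
        rw [this, ← mul_assoc, mul_comm (#P : ℝ) l, mul_assoc]
        exact congrArg (l * ·) (mul_div_cancel₀ _ hN.ne').symm
      rw [e1, e2, mul_div_cancel_left₀ _ hN.ne'] at h1
      have h2 : l * F' l - F l * Real.log (F l) ≤ c * l ^ 2 * F l := by
        refine le_of_mul_le_mul_left ?_ hN
        linarith
      have hFl := hFpos l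
      have h3 : F' l / F l * l - Real.log (F l) ≤ c * l ^ 2 := by
        rw [div_mul_eq_mul_div, div_sub' hFl.ne', div_le_iff₀ hFl]
        linarith
      have h4 : (F' l / F l * l - Real.log (F l) * 1) / l ^ 2 ≤ c := by
        rw [div_le_iff₀ (by positivity)]; linarith
      linarith
  have hF0 : F 0 = 1 := by simp [hF, hN.ne']
  have hF'0 : F' 0 = (∑ w ∈ P, Z w) / (#P : ℝ) := by simp [hF']
  have hlim : Filter.Tendsto G (nhdsWithin 0 (Set.Ioi 0))
      (nhds ((∑ w ∈ P, Z w) / (#P : ℝ))) := by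
    have h1 := (hasDerivAt_iff_tendsto_slope.1 (hdlog 0)).mono_left
      (nhdsWithin_mono (0 : ℝ) (fun x hx => (ne_of_gt hx : x ≠ 0)) :
        nhdsWithin 0 (Set.Ioi 0) ≤ nhdsWithin 0 ({0}ᶜ : Set ℝ))
    have h2 : Filter.Tendsto (fun l : ℝ => c * l) (nhdsWithin 0 (Set.Ioi 0)) (nhds 0) := by
      have : Filter.Tendsto (fun l : ℝ => c * l) (nhds 0) (nhds (c * 0)) :=
        (continuous_const.mul continuous_id).tendsto 0
      rw [mul_zero] at this
      exact this.mono_left nhdsWithin_le_nhds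
    have h3 := h1.sub h2
    rw [hF0, div_one, hF'0, sub_zero] at h3
    refine h3.congr fun l => ?_
    simp only [hG, slope_def_field, hF0, Real.log_one, sub_zero]
  have hle : G l ≤ (∑ w ∈ P, Z w) / (#P : ℝ) := by
    refine ge_of_tendsto hlim ?_
    filter_upwards [Ioo_mem_nhdsGT hl] with e he
    exact hanti he.1 hl he.2.le
  have h5 : Real.log (F l) ≤ l * ((∑ w ∈ P, Z w) / (#P : ℝ)) + c * l ^ 2 := by
    have h6 : Real.log (F l) / l ≤ (∑ w ∈ P, Z w) / (#P : ℝ) + c * l := by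
      simp only [hG] at hle; linarith
    rw [div_le_iff₀ hl] at h6
    linarith
  calc F l = Real.exp (Real.log (F l)) := (Real.exp_log (hFpos l)).symm
    _ ≤ _ := Real.exp_le_exp.2 h5

/-- From `1 - e^{-t} ≤ t`. The weight is the exponential at the larger point, so that reversibility
later leaves only decreases of `Z`. -/
lemma logDiff_exp_le (x y : ℝ) :
    logDiff (Real.exp x) (Real.exp y)
      ≤ Real.exp x * (max (x - y) 0) ^ 2 + Real.exp y * (max (y - x) 0) ^ 2 := by
  have aux : ∀ x y : ℝ, y ≤ x → logDiff (Real.exp x) (Real.exp y) ≤ Real.exp x * (x - y) ^ 2 := by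
    intro x y hxy
    unfold logDiff
    rw [Real.log_exp, Real.log_exp]
    have h1 : Real.exp x - Real.exp y ≤ Real.exp x * (x - y) := by
      have h2 := Real.add_one_le_exp (y - x)
      have h3 : Real.exp y = Real.exp x * Real.exp (y - x) := by
        rw [← Real.exp_add]; congr 1; ring
      rw [h3]
      nlinarith [Real.exp_pos x]
    nlinarith
  rcases le_total y x with h | h
  · rw [max_eq_left (by linarith), max_eq_right (by linarith : y - x ≤ 0)]
    simpa using aux x y h
  · rw [max_eq_left (by linarith : 0 ≤ y - x), max_eq_right (by linarith : x - y ≤ 0)]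
    have h1 := aux y x h
    have h2 : logDiff (Real.exp x) (Real.exp y) = logDiff (Real.exp y) (Real.exp x) := by
      unfold logDiff; ring
    rw [h2]
    simpa using h1

/-! ### Means over slices and upper tails from squared decreases. -/

section Slice

variable {α : Type*}

/-- The mean of `f` over the `k`-subsets of `s`. -/
noncomputable def sliceMean (s : Finset α) (k : ℕ) (f : Finset α → ℝ) : ℝ :=
  (∑ W ∈ s.powersetCard k, f W) / (s.card.choose k : ℝ)

lemma sliceMean_le {s : Finset α} {k : ℕ} {f g : Finset α → ℝ}
    (h : ∀ W ∈ s.powersetCard k, f W ≤ g W) : sliceMean s k f ≤ sliceMean s k g :=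
  div_le_div_of_nonneg_right (Finset.sum_le_sum h) (Nat.cast_nonneg _)

lemma sliceMean_add (s : Finset α) (k : ℕ) (f g : Finset α → ℝ) :
    sliceMean s k (fun W => f W + g W) = sliceMean s k f + sliceMean s k g := by
  unfold sliceMean; rw [Finset.sum_add_distrib, add_div]

lemma sliceMean_const_mul (s : Finset α) (k : ℕ) (c : ℝ) (f : Finset α → ℝ) :
    sliceMean s k (fun W => c * f W) = c * sliceMean s k f := by
  unfold sliceMean; rw [← Finset.mul_sum, mul_div_assoc]

lemma sliceMean_const {s : Finset α} {k : ℕ} (hk : k ≤ s.card) (c : ℝ) :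
    sliceMean s k (fun _ => c) = c := by
  have hNp : (0 : ℝ) < (s.card.choose k : ℝ) := by exact_mod_cast Nat.choose_pos hk
  unfold sliceMean
  rw [Finset.sum_const, Finset.card_powersetCard, nsmul_eq_mul, mul_div_cancel_left₀ _ hNp.ne']

lemma sliceMean_sum (s : Finset α) (k : ℕ) {ι : Type*} (t : Finset ι) (f : ι → Finset α → ℝ) :
    sliceMean s k (fun W => ∑ i ∈ t, f i W) = ∑ i ∈ t, sliceMean s k (f i) := by
  unfold sliceMean; rw [Finset.sum_comm, Finset.sum_div]

lemma sliceMean_sq_le {s : Finset α} {k : ℕ} (f : Finset α → ℝ) :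
    sliceMean s k f ^ 2 ≤ sliceMean s k (fun W => f W ^ 2) := by
  unfold sliceMean
  have h := sq_sum_le_card_mul_sum_sq (s := s.powersetCard k) (f := f)
  rw [Finset.card_powersetCard] at h
  rcases (Nat.cast_nonneg (α := ℝ) (s.card.choose k)).eq_or_lt with h0 | h0
  · rw [← h0]; simp
  · rw [div_pow, div_le_div_iff₀ (by positivity) h0]
    nlinarith

variable [DecidableEq α]

lemma exchange_exchange {W : Finset α} {a b : α} (ha : a ∈ W) (hb : b ∉ W) :
    exchange (exchange W a b) b a = W := by
  unfold exchange
  rw [Finset.erase_insert (fun h => hb (Finset.mem_of_mem_erase h)), Finset.insert_erase ha]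

lemma exchange_mem_powersetCard {s W : Finset α} {k : ℕ} {a b : α} (hW : W ∈ s.powersetCard k)
    (ha : a ∈ W) (hb : b ∈ s \ W) : exchange W a b ∈ s.powersetCard k := by
  have hW' := Finset.mem_powersetCard.1 hW
  have hb' := Finset.mem_sdiff.1 hb
  refine Finset.mem_powersetCard.2 ⟨?_, ?_⟩
  · exact Finset.insert_subset hb'.1 ((Finset.erase_subset _ _).trans hW'.1)
  · unfold exchange
    rw [Finset.card_insert_of_notMem (fun h => hb'.2 (Finset.mem_of_mem_erase h)),
      Finset.card_erase_add_one ha, hW'.2]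

/-- Reversibility of the exchange walk. -/
lemma sum_exchange_comm (s : Finset α) (k : ℕ) (H : Finset α → Finset α → ℝ) :
    ∑ W ∈ s.powersetCard k, ∑ a ∈ W, ∑ b ∈ s \ W, H W (exchange W a b)
      = ∑ W ∈ s.powersetCard k, ∑ a ∈ W, ∑ b ∈ s \ W, H (exchange W a b) W := by
  simp_rw [← Finset.sum_product']
  rw [Finset.sum_sigma', Finset.sum_sigma']
  have mem : ∀ p : (_ : Finset α) × (α × α),
      p ∈ (s.powersetCard k).sigma (fun W => W ×ˢ (s \ W)) →
      (⟨exchange p.1 p.2.1 p.2.2, (p.2.2, p.2.1)⟩ : (_ : Finset α) × (α × α))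
        ∈ (s.powersetCard k).sigma (fun W => W ×ˢ (s \ W)) := by
    rintro ⟨W, a, b⟩ h
    simp only [Finset.mem_sigma, Finset.mem_product] at h ⊢
    obtain ⟨hW, ha, hb⟩ := h
    refine ⟨exchange_mem_powersetCard hW ha hb, Finset.mem_insert_self _ _, ?_⟩
    have hb' := Finset.mem_sdiff.1 hb
    refine Finset.mem_sdiff.2 ⟨(Finset.mem_powersetCard.1 hW).1 ha, ?_⟩
    unfold exchange
    rw [Finset.mem_insert, not_or]
    exact ⟨fun h => hb'.2 (h ▸ ha), Finset.notMem_erase _ _⟩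
  have inv : ∀ p : (_ : Finset α) × (α × α),
      p ∈ (s.powersetCard k).sigma (fun W => W ×ˢ (s \ W)) →
      exchange (exchange p.1 p.2.1 p.2.2) p.2.2 p.2.1 = p.1 := by
    rintro ⟨W, a, b⟩ h
    simp only [Finset.mem_sigma, Finset.mem_product, Finset.mem_sdiff] at h
    exact exchange_exchange h.2.1 h.2.2.2
  refine Finset.sum_bij' (fun p _ => ⟨exchange p.1 p.2.1 p.2.2, (p.2.2, p.2.1)⟩)
    (fun p _ => ⟨exchange p.1 p.2.1 p.2.2, (p.2.2, p.2.1)⟩) mem mem ?_ ?_ ?_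
  · intro p hp; simp only [inv p hp]
  · intro p hp; simp only [inv p hp]
  · intro p hp; simp only [inv p hp]

/-- The sum of the squared decreases of `Z` along the exchanges of `W`. -/
noncomputable def downVar (s : Finset α) (Z : Finset α → ℝ) (W : Finset α) : ℝ :=
  ∑ a ∈ W, ∑ b ∈ s \ W, (max (Z W - Z (exchange W a b)) 0) ^ 2

/-- Each exchange contributes a decrease seen from one of its endpoints. Reversibility equates the
two kinds of contribution, whence the factor 2. -/
lemma card_mul_sliceEnt_exp_le (s : Finset α) (k : ℕ) (Z : Finset α → ℝ) {l : ℝ} (hl : 0 < l) :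
    (s.card : ℝ) * sliceEnt s k (fun W => Real.exp (l * Z W))
      ≤ ∑ W ∈ s.powersetCard k, Real.exp (l * Z W) * (2 * l ^ 2 * downVar s Z W) := by
  refine (card_mul_sliceEnt_le s k fun _ => Real.exp_pos _).trans ?_
  unfold sliceDir
  set H : Finset α → Finset α → ℝ := fun A B =>
    Real.exp (l * Z A) * (max (l * Z A - l * Z B) 0) ^ 2 with hH
  have h1 : ∑ W ∈ s.powersetCard k, ∑ a ∈ W, ∑ b ∈ s \ W,
      logDiff (Real.exp (l * Z W)) (Real.exp (l * Z (exchange W a b)))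
      ≤ ∑ W ∈ s.powersetCard k, ∑ a ∈ W, ∑ b ∈ s \ W,
        (H W (exchange W a b) + H (exchange W a b) W) :=
    Finset.sum_le_sum fun W _ => Finset.sum_le_sum fun a _ => Finset.sum_le_sum fun b _ =>
      logDiff_exp_le _ _
  refine h1.trans (le_of_eq ?_)
  simp_rw [Finset.sum_add_distrib]
  rw [← sum_exchange_comm s k H, ← two_mul, Finset.mul_sum]
  refine Finset.sum_congr rfl fun W _ => ?_
  unfold downVar
  simp_rw [Finset.mul_sum]
  refine Finset.sum_congr rfl fun a _ => Finset.sum_congr rfl fun b _ => ?_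
  simp only [hH]
  have : max (l * Z W - l * Z (exchange W a b)) 0 = l * max (Z W - Z (exchange W a b)) 0 := by
    rw [← mul_sub, mul_max_of_nonneg _ _ hl.le, mul_zero]
  rw [this]; ring

/-- Sub-Gaussian upper tail for a function whose squared decreases are bounded. -/
theorem card_ge_le_of_downVar_le {s : Finset α} {k : ℕ} (hk : k ≤ s.card) (Z : Finset α → ℝ)
    {c : ℝ} (hc : 0 < c) (hs : 0 < s.card)
    (hZ : ∀ W ∈ s.powersetCard k, 2 * downVar s Z W ≤ c * s.card) {t : ℝ} (ht : 0 < t) :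
    (#{W ∈ s.powersetCard k | sliceMean s k Z + t ≤ Z W} : ℝ)
      ≤ Real.exp (-(t ^ 2 / (4 * c))) * (s.card.choose k : ℝ) := by
  have hsp : (0 : ℝ) < s.card := by exact_mod_cast hs
  have hne : (s.powersetCard k).Nonempty := Finset.powersetCard_nonempty.2 hk
  have hcard : (#(s.powersetCard k) : ℝ) = (s.card.choose k : ℝ) := by
    rw [Finset.card_powersetCard]
  have hNp : (0 : ℝ) < (s.card.choose k : ℝ) := by exact_mod_cast Nat.choose_pos hk
  -- The minimizer of the Chernoff exponent `c l² - l t`.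
  set l := t / (2 * c) with hl
  have hlp : 0 < l := by positivity
  have hexp := sum_exp_le_of_entropy hne Z (c := c) (fun l hl => by
    have h1 := card_mul_sliceEnt_exp_le s k Z hl
    unfold sliceEnt at h1
    simp only [Real.log_exp] at h1
    rw [hcard]
    refine le_of_mul_le_mul_left (h1.trans ?_) hsp
    rw [Finset.mul_sum, Finset.mul_sum]
    refine Finset.sum_le_sum fun W hW => ?_
    have h2 := mul_le_mul_of_nonneg_left (hZ W hW)
      (show 0 ≤ Real.exp (l * Z W) * l ^ 2 by positivity)
    linarith) hlp
  rw [hcard, div_le_iff₀ hNp] at hexp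
  set B := (s.powersetCard k).filter fun W => sliceMean s k Z + t ≤ Z W with hB
  have hlow : (#B : ℝ) * Real.exp (l * (sliceMean s k Z + t))
      ≤ ∑ W ∈ s.powersetCard k, Real.exp (l * Z W) := by
    rw [← nsmul_eq_mul, ← Finset.sum_const]
    refine (Finset.sum_le_sum (g := fun W => Real.exp (l * Z W)) fun W hW => ?_).trans
      (Finset.sum_le_sum_of_subset_of_nonneg (Finset.filter_subset _ _)
        fun _ _ _ => (Real.exp_pos _).le)
    exact Real.exp_le_exp.2 (mul_le_mul_of_nonneg_left (Finset.mem_filter.1 hW).2 hlp.le)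
  have h3 := hlow.trans hexp
  have h4 : Real.exp (l * ((∑ W ∈ s.powersetCard k, Z W) / (s.card.choose k : ℝ)) + c * l ^ 2)
      = Real.exp (-(t ^ 2 / (4 * c))) * Real.exp (l * (sliceMean s k Z + t)) := by
    rw [← Real.exp_add]
    congr 1
    rw [sliceMean, hl]
    field_simp
    ring
  rw [h4, mul_right_comm] at h3
  exact le_of_mul_le_mul_right h3 (Real.exp_pos _)

/-- Upper tail for a positive function whose squared decreases are bounded by a multiple of
itself. -/
theorem card_gt_le_of_selfBounding {s : Finset α} {k : ℕ} (hk : k ≤ s.card) (hs : 0 < s.card)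
    {Z : Finset α → ℝ} (hZ0 : ∀ W, 0 < Z W) {c : ℝ} (hc : 0 < c)
    (hZ : ∀ W ∈ s.powersetCard k, 2 * downVar s Z W ≤ c * s.card * Z W) {x : ℝ} (hx : 0 < x) :
    (#{W ∈ s.powersetCard k | 2 * sliceMean s k Z + 8 * c * x < Z W} : ℝ)
      ≤ Real.exp (-x) * (s.card.choose k : ℝ) := by
  set Y : Finset α → ℝ := fun W => √(Z W) with hY
  have hYsq : ∀ W, Y W ^ 2 = Z W := fun W => Real.sq_sqrt (hZ0 W).le
  have hY0 : ∀ W, 0 < Y W := fun W => Real.sqrt_pos.2 (hZ0 W)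
  set t := 2 * √(c * x) with ht
  have htp : 0 < t := by positivity
  have htsq : t ^ 2 = 4 * c * x := by
    rw [ht, mul_pow, Real.sq_sqrt (by positivity)]; ring
  -- If `Z W ≥ Z V`, then `(√(Z W) - √(Z V)) √(Z W) ≤ Z W - Z V`; squaring cancels the factor `Z W`
  -- of the hypothesis.
  have hdown : ∀ W ∈ s.powersetCard k, 2 * downVar s Y W ≤ c * s.card := by
    intro W hW
    refine le_of_mul_le_mul_right (a := Z W) ?_ (hZ0 W)
    refine le_trans ?_ (hZ W hW)
    rw [mul_assoc]
    refine mul_le_mul_of_nonneg_left ?_ (by norm_num)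
    unfold downVar
    simp_rw [Finset.sum_mul]
    refine Finset.sum_le_sum fun a _ => Finset.sum_le_sum fun b _ => ?_
    set V := exchange W a b
    rw [← hYsq W, ← mul_pow]
    have h0 : 0 ≤ max (Y W - Y V) 0 := le_max_right _ _
    refine pow_le_pow_left₀ (mul_nonneg h0 (hY0 W).le) ?_ 2
    have hW0 := hY0 W
    have hV0 := hY0 V
    rw [← hYsq V]
    rcases le_total (Y W) (Y V) with h | h
    · rw [max_eq_right (by linarith : Y W - Y V ≤ 0), zero_mul]
      exact le_max_right _ _
    · rw [max_eq_left (by linarith : 0 ≤ Y W - Y V)]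
      refine le_trans ?_ (le_max_left _ _)
      nlinarith
  have key := card_ge_le_of_downVar_le hk Y hc hs hdown htp
  have he : t ^ 2 / (4 * c) = x := by rw [htsq]; field_simp
  rw [he] at key
  refine le_trans ?_ key
  refine Nat.cast_le.2 (Finset.card_le_card fun W hW => ?_)
  rw [Finset.mem_filter] at hW ⊢
  refine ⟨hW.1, ?_⟩
  -- Otherwise `Z W ≤ (E√Z + t)² ≤ 2 (E√Z)² + 2 t² ≤ 2 EZ + 8 c x`.
  by_contra hcon
  push Not at hcon
  have hm : sliceMean s k Y ^ 2 ≤ sliceMean s k Z := by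
    refine (sliceMean_sq_le Y).trans (le_of_eq ?_)
    simp only [hYsq]
  have h1 : Y W ^ 2 ≤ (sliceMean s k Y + t) ^ 2 := pow_le_pow_left₀ (hY0 W).le hcon.le 2
  rw [hYsq] at h1
  have h2 := hW.2
  nlinarith [sq_nonneg (sliceMean s k Y - t)]

end Slice

/-! ### Suprema of deviations of a uniform random subset -/

section Slice

variable {α : Type*}

/-- The deviation of the average of `v` over `W`, a set of size `k`, from that over `s`. -/
noncomputable def sliceDev (s : Finset α) (k : ℕ) (W : Finset α) (v : α → ℝ) : ℝ :=
  1 / (k : ℝ) * ∑ i ∈ W, v i - 1 / (#s : ℝ) * ∑ i ∈ s, v i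

lemma sliceDev_smul (s : Finset α) (k : ℕ) (W : Finset α) (c : ℝ) (v : α → ℝ) :
    sliceDev s k W (fun i => c * v i) = c * sliceDev s k W v := by
  unfold sliceDev
  rw [← Finset.mul_sum, ← Finset.mul_sum]; ring

lemma abs_sliceDev_le (s : Finset α) (k : ℕ) (W : Finset α) {v : α → ℝ} {L : ℝ}
    (hv : ∀ i, |v i| ≤ L) :
    |sliceDev s k W v| ≤ 1 / (k : ℝ) * (#W * L) + 1 / (#s : ℝ) * (#s * L) := by
  have h : ∀ A : Finset α, |∑ i ∈ A, v i| ≤ #A * L := fun A => by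
    refine (Finset.abs_sum_le_sum_abs _ _).trans ((Finset.sum_le_sum fun i _ => hv i).trans ?_)
    rw [Finset.sum_const, nsmul_eq_mul]
  unfold sliceDev
  refine (abs_sub _ _).trans (add_le_add ?_ ?_)
  · rw [abs_mul, abs_of_nonneg (by positivity : (0 : ℝ) ≤ 1 / (k : ℝ))]
    exact mul_le_mul_of_nonneg_left (h _) (by positivity)
  · rw [abs_mul, abs_of_nonneg (by positivity : (0 : ℝ) ≤ 1 / (#s : ℝ))]
    exact mul_le_mul_of_nonneg_left (h _) (by positivity)

/-- A real `⨆` over an unbounded family has the default value 0, so every use of `le_ciSup` below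
needs such a bound. -/
lemma bddAbove_range_sliceDev {ι : Type*} (s : Finset α) (k : ℕ) (W : Finset α)
    {v : ι → α → ℝ} {L : ℝ} (hv : ∀ j i, |v j i| ≤ L) :
    BddAbove (Set.range fun j => sliceDev s k W (v j)) := by
  refine ⟨1 / (k : ℝ) * (#W * L) + 1 / (#s : ℝ) * (#s * L), ?_⟩
  rintro _ ⟨j, rfl⟩
  exact (le_abs_self _).trans (abs_sliceDev_le s k W (hv j))

variable [DecidableEq α]

lemma sum_exchange {W : Finset α} {a b : α} (ha : a ∈ W) (hb : b ∉ W) (z : α → ℝ) :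
    ∑ i ∈ exchange W a b, z i = ∑ i ∈ W, z i - z a + z b := by
  unfold exchange
  rw [Finset.sum_insert (fun h => hb (Finset.mem_of_mem_erase h)),
    ← Finset.add_sum_erase W z ha]
  ring

/-- An index nearly optimal at `W` is still a competitor after the exchange, so the decrease is at
most `(z_a - z_b)⁺ / k + ε` for one `j` serving all exchanges. The 2 comes from `(p + ε)² ≤ 2p² +
2ε²`; the supremum need not be attained. -/
lemma downVar_iSup_le {ι : Type*} [Nonempty ι] {s : Finset α} {k : ℕ} {W : Finset α}
    (z : ι → α → ℝ) (e : ι → ℝ) (e₀ : ℝ)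
    (hb : ∀ W : Finset α, BddAbove (Set.range fun j => 1 / (k : ℝ) * ∑ i ∈ W, z j i - e j))
    {M : ℝ} (hM : ∀ j, ∑ a ∈ W, ∑ b ∈ s \ W, (max (z j a - z j b) 0) ^ 2 ≤ M) :
    downVar s (fun W => e₀ + ⨆ j, (1 / (k : ℝ) * ∑ i ∈ W, z j i - e j)) W
      ≤ 2 / (k : ℝ) ^ 2 * M := by
  refine le_of_forall_pos_le_add fun δ hδ => ?_
  set N : ℝ := (#W : ℝ) * (#(s \ W) : ℝ) with hN
  have hN0 : 0 ≤ N := by positivity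
  set ε := √(δ / (2 * N + 1)) with hε
  have hε0 : 0 < ε := Real.sqrt_pos.2 (by positivity)
  have hεN : 2 * N * ε ^ 2 ≤ δ := by
    rw [hε, Real.sq_sqrt (by positivity), mul_div_assoc', div_le_iff₀ (by positivity)]
    nlinarith
  obtain ⟨j, hj⟩ := exists_lt_of_lt_ciSup
    (sub_lt_self (⨆ j, (1 / (k : ℝ) * ∑ i ∈ W, z j i - e j)) hε0)
  have h1 : downVar s (fun W => e₀ + ⨆ j, (1 / (k : ℝ) * ∑ i ∈ W, z j i - e j)) W
      ≤ ∑ a ∈ W, ∑ b ∈ s \ W, (2 / (k : ℝ) ^ 2 * (max (z j a - z j b) 0) ^ 2 + 2 * ε ^ 2) := by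
    unfold downVar
    refine Finset.sum_le_sum fun a ha => Finset.sum_le_sum fun b hb' => ?_
    have hbW := (Finset.mem_sdiff.1 hb').2
    have h2 : 1 / (k : ℝ) * (∑ i ∈ W, z j i - z j a + z j b) - e j
        ≤ ⨆ j, (1 / (k : ℝ) * ∑ i ∈ exchange W a b, z j i - e j) := by
      rw [← sum_exchange ha hbW (z j)]
      exact le_ciSup (hb (exchange W a b)) j
    set m := max (z j a - z j b) 0 with hm
    have hm1 : z j a - z j b ≤ m := le_max_left _ _
    have hm0 : 0 ≤ m := le_max_right _ _
    have hk0 : 0 ≤ 1 / (k : ℝ) := by positivity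
    have h3 : max ((e₀ + ⨆ j, (1 / (k : ℝ) * ∑ i ∈ W, z j i - e j))
        - (e₀ + ⨆ j, (1 / (k : ℝ) * ∑ i ∈ exchange W a b, z j i - e j))) 0
        ≤ 1 / (k : ℝ) * m + ε := by
      refine max_le ?_ (by positivity)
      have := mul_le_mul_of_nonneg_left hm1 hk0
      linarith
    refine (pow_le_pow_left₀ (le_max_right _ _) h3 2).trans ?_
    have h4 : 2 / (k : ℝ) ^ 2 * m ^ 2 = 2 * (1 / (k : ℝ) * m) ^ 2 := by ring
    rw [h4]
    nlinarith [sq_nonneg (1 / (k : ℝ) * m - ε)]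
  refine h1.trans ?_
  simp_rw [Finset.sum_add_distrib, ← Finset.mul_sum, Finset.sum_const, nsmul_eq_mul]
  have h5 : (0 : ℝ) ≤ 2 / (k : ℝ) ^ 2 := by positivity
  have h6 := mul_le_mul_of_nonneg_left (hM j) h5
  have h7 : (#W : ℝ) * (#(s \ W) * (2 * ε ^ 2)) = 2 * N * ε ^ 2 := by rw [hN]; ring
  linarith

/-- Uniform deviation bound for a bounded class of functions on a finite set, in terms of the
expected suprema of the deviations of the functions and of their squares. -/
theorem card_exists_sliceDev_gt_le {ι : Type*} {s : Finset α} {k : ℕ} (hk0 : 1 ≤ k)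
    (hk : k ≤ #s) {w : ι → α → ℝ} {L r θ : ℝ} (hθ : 0 < θ) (hr : 0 < r)
    (hL : ∀ j i, |w j i| ≤ L) (hvar : ∀ j, 1 / (#s : ℝ) * ∑ i ∈ s, w j i ^ 2 ≤ r)
    {j₀ : ι} (hj₀ : ∀ i, w j₀ i = 0) {x : ℝ} (hx : 0 < x) :
    ∃ Bad : Finset (Finset α), (#Bad : ℝ) ≤ Real.exp (-x) * ((#s).choose k : ℝ) ∧
      ∀ W ∈ s.powersetCard k, W ∉ Bad → ∀ j, sliceDev s k W (w j)
        ≤ 2 * sliceMean s k (fun W => ⨆ j, sliceDev s k W (w j))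
          + 2 * θ * sliceMean s k (fun W => ⨆ j, sliceDev s k W (fun i => w j i ^ 2))
          + 4 * θ * r + 8 * ((16 + 8 * θ ^ 2 * L ^ 2) / (θ * k)) * x := by
  have : Nonempty ι := ⟨j₀⟩
  have hkp : (0 : ℝ) < k := by exact_mod_cast hk0
  have hs : 0 < #s := by omega
  have hsp : (0 : ℝ) < #s := by exact_mod_cast hs
  have hL2 : ∀ j i, |w j i ^ 2| ≤ L ^ 2 := fun j i => by
    rw [abs_pow]; exact pow_le_pow_left₀ (abs_nonneg _) (hL j i) 2
  have hL2' : ∀ j i, w j i ^ 2 ≤ L ^ 2 := fun j i => (le_abs_self _).trans (hL2 j i)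
  -- Pairs of indices let the deviation and the second moment be maximized separately. With `j₀`,
  -- the zero function, in either slot, `Z` controls each of them alone.
  set z : ι × ι → α → ℝ := fun p i => w p.1 i + θ * w p.2 i ^ 2 with hz
  set e : ι × ι → ℝ := fun p => 1 / (#s : ℝ) * ∑ i ∈ s, w p.1 i with he
  have hval : ∀ (W : Finset α) (p : ι × ι), 1 / (k : ℝ) * ∑ i ∈ W, z p i - e p
      = sliceDev s k W (w p.1) + θ * (1 / (k : ℝ) * ∑ i ∈ W, w p.2 i ^ 2) := by
    intro W p
    simp only [hz, he, sliceDev, Finset.sum_add_distrib, ← Finset.mul_sum]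
    ring
  have hdev0 : ∀ W : Finset α, sliceDev s k W (w j₀) = 0 := fun W => by
    simp [sliceDev, hj₀]
  have hb : ∀ W : Finset α, BddAbove (Set.range fun p => 1 / (k : ℝ) * ∑ i ∈ W, z p i - e p) := by
    intro W
    obtain ⟨B, hB⟩ := bddAbove_range_sliceDev s k W hL
    refine ⟨B + θ * (1 / (k : ℝ) * (#W * L ^ 2)), ?_⟩
    rintro _ ⟨p, rfl⟩
    simp only [hval]
    refine add_le_add (hB ⟨p.1, rfl⟩) (mul_le_mul_of_nonneg_left
      (mul_le_mul_of_nonneg_left ?_ (by positivity)) hθ.le)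
    refine (Finset.sum_le_sum fun i _ => hL2' p.2 i).trans ?_
    rw [Finset.sum_const, nsmul_eq_mul]
  set Z : Finset α → ℝ := fun W => θ * r + ⨆ p, (1 / (k : ℝ) * ∑ i ∈ W, z p i - e p) with hZ
  have hZge : ∀ (W : Finset α) (j j' : ι), θ * r + (sliceDev s k W (w j)
      + θ * (1 / (k : ℝ) * ∑ i ∈ W, w j' i ^ 2)) ≤ Z W := by
    intro W j j'
    have := le_ciSup (hb W) (j, j')
    simp only [hval] at this
    simp only [hZ, hval]
    linarith
  have hsqW : ∀ (W : Finset α) (j : ι), 0 ≤ 1 / (k : ℝ) * ∑ i ∈ W, w j i ^ 2 :=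
    fun W j => mul_nonneg (by positivity) (Finset.sum_nonneg fun i _ => sq_nonneg _)
  have hZ0 : ∀ W, 0 < Z W := fun W => by
    have h1 := hZge W j₀ j₀
    rw [hdev0] at h1
    have h2 := mul_nonneg hθ.le (hsqW W j₀)
    have := mul_pos hθ hr
    linarith
  set c := (16 + 8 * θ ^ 2 * L ^ 2) / (θ * k) with hc
  have hcp : 0 < c := by positivity
  have hdown : ∀ W ∈ s.powersetCard k, 2 * downVar s Z W ≤ c * #s * Z W := by
    intro W hW
    obtain ⟨hWs, hWk⟩ := Finset.mem_powersetCard.1 hW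
    set A := (Z W - θ * r) / θ with hA
    have hsq : ∀ j, ∑ i ∈ W, w j i ^ 2 ≤ k * A := by
      intro j
      have h1 := hZge W j₀ j
      rw [hdev0, zero_add] at h1
      have h2 : 1 / (k : ℝ) * ∑ i ∈ W, w j i ^ 2 ≤ A := by
        rw [hA, le_div_iff₀ hθ]; linarith
      rwa [one_div, ← div_eq_inv_mul, div_le_iff₀' hkp] at h2
    have hsd : (#(s \ W) : ℝ) ≤ #s := by
      exact_mod_cast Finset.card_le_card Finset.sdiff_subset
    have hA0 : 0 ≤ A := by
      have h1 := (Finset.sum_nonneg fun i _ => sq_nonneg (w j₀ i)).trans (hsq j₀)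
      exact nonneg_of_mul_nonneg_right h1 hkp
    -- Points `a ∈ W` are paid by the second-moment part of `Z`, points `b ∉ W` by the summand `θ
    -- r`; together `A + r = Z W / θ`. The square at `b` enters `z_a - z_b` negatively and is
    -- dropped.
    have hM : ∀ p, ∑ a ∈ W, ∑ b ∈ s \ W, (max (z p a - z p b) 0) ^ 2
        ≤ #s * k * (4 + 2 * θ ^ 2 * L ^ 2) * (Z W / θ) := by
      intro p
      have h1 : ∀ a b, (max (z p a - z p b) 0) ^ 2
          ≤ (4 * w p.1 a ^ 2 + 2 * θ ^ 2 * L ^ 2 * w p.2 a ^ 2) + 4 * w p.1 b ^ 2 := by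
        intro a b
        have h2 : max (z p a - z p b) 0 ≤ |w p.1 a - w p.1 b| + θ * w p.2 a ^ 2 := by
          refine max_le ?_ (by positivity)
          have h3 := le_abs_self (w p.1 a - w p.1 b)
          have h4 : 0 ≤ θ * w p.2 b ^ 2 := by positivity
          simp only [hz]
          linarith
        have h5 := pow_le_pow_left₀ (le_max_right _ _) h2 2
        have h6 : (θ * w p.2 a ^ 2) ^ 2 ≤ θ ^ 2 * L ^ 2 * w p.2 a ^ 2 := by
          have := mul_le_mul_of_nonneg_left (hL2' p.2 a)
            (show 0 ≤ θ ^ 2 * w p.2 a ^ 2 by positivity)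
          nlinarith
        have h7 := sq_abs (w p.1 a - w p.1 b)
        nlinarith [sq_nonneg (|w p.1 a - w p.1 b| - θ * w p.2 a ^ 2),
          sq_nonneg (w p.1 a + w p.1 b)]
      refine (Finset.sum_le_sum fun a _ => Finset.sum_le_sum fun b _ => h1 a b).trans ?_
      simp_rw [Finset.sum_add_distrib, Finset.sum_const, nsmul_eq_mul, ← Finset.mul_sum]
      rw [hWk]
      have h8 : ∑ b ∈ s \ W, w p.1 b ^ 2 ≤ #s * r := by
        refine (Finset.sum_le_sum_of_subset_of_nonneg Finset.sdiff_subset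
          fun _ _ _ => sq_nonneg _).trans ?_
        have := hvar p.1
        rwa [one_div, ← div_eq_inv_mul, div_le_iff₀' hsp] at this
      have h9 : 4 * ∑ a ∈ W, w p.1 a ^ 2 + 2 * θ ^ 2 * L ^ 2 * ∑ a ∈ W, w p.2 a ^ 2
          ≤ (4 + 2 * θ ^ 2 * L ^ 2) * (k * A) := by
        have := mul_le_mul_of_nonneg_left (hsq p.2)
          (show 0 ≤ 2 * θ ^ 2 * L ^ 2 by positivity)
        have := hsq p.1
        linarith
      have h10 : (#(s \ W) : ℝ) * (4 * ∑ a ∈ W, w p.1 a ^ 2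
          + 2 * θ ^ 2 * L ^ 2 * ∑ a ∈ W, w p.2 a ^ 2)
          ≤ #s * ((4 + 2 * θ ^ 2 * L ^ 2) * (k * A)) :=
        mul_le_mul hsd h9 (add_nonneg
          (mul_nonneg (by norm_num) (Finset.sum_nonneg fun _ _ => sq_nonneg _))
          (mul_nonneg (by positivity) (Finset.sum_nonneg fun _ _ => sq_nonneg _))) hsp.le
      have h11 : (k : ℝ) * (4 * ∑ b ∈ s \ W, w p.1 b ^ 2) ≤ k * (4 * (#s * r)) :=
        mul_le_mul_of_nonneg_left (by linarith) hkp.le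
      have h12 : Z W / θ = A + r := by rw [hA]; field_simp; ring
      rw [h12]
      have h13 : 0 ≤ (#s : ℝ) * k * (2 * θ ^ 2 * L ^ 2) * r := by positivity
      linarith
    have h1 := downVar_iSup_le z e (θ * r) hb hM
    refine (mul_le_mul_of_nonneg_left h1 (by norm_num)).trans (le_of_eq ?_)
    rw [hc]
    field_simp
    ring
  have key := card_gt_le_of_selfBounding hk hs hZ0 hcp hdown hx
  refine ⟨_, key, fun W hWm hW j => ?_⟩
  have hW' : Z W ≤ 2 * sliceMean s k Z + 8 * c * x := by
    by_contra hcon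
    exact hW (Finset.mem_filter.2 ⟨hWm, not_le.1 hcon⟩)
  -- Centering the second moments costs another `θ r`, since their averages over `s` are at most
  -- `r`.
  have hmean : sliceMean s k Z ≤ sliceMean s k (fun W => ⨆ j, sliceDev s k W (w j))
      + θ * sliceMean s k (fun W => ⨆ j, sliceDev s k W (fun i => w j i ^ 2)) + 2 * θ * r := by
    have h1 : sliceMean s k Z ≤ sliceMean s k (fun W => (⨆ j, sliceDev s k W (w j))
        + (θ * (⨆ j, sliceDev s k W (fun i => w j i ^ 2)) + 2 * θ * r)) := by
      refine sliceMean_le fun V _ => ?_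
      simp only [hZ]
      have h2 : (⨆ p, (1 / (k : ℝ) * ∑ i ∈ V, z p i - e p))
          ≤ (⨆ j, sliceDev s k V (w j))
            + θ * ((⨆ j, sliceDev s k V (fun i => w j i ^ 2)) + r) := by
        refine ciSup_le fun p => ?_
        rw [hval]
        refine add_le_add (le_ciSup (bddAbove_range_sliceDev s k V hL) p.1)
          (mul_le_mul_of_nonneg_left ?_ hθ.le)
        have h3 := le_ciSup (bddAbove_range_sliceDev s k V hL2) p.2
        have h4 := hvar p.2
        simp only [sliceDev] at h3 ⊢
        linarith
      linarith
    refine h1.trans (le_of_eq ?_)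
    rw [sliceMean_add, sliceMean_add, sliceMean_const_mul, sliceMean_const hk]
    ring
  have h2 := hZge W j j₀
  have h3 := mul_nonneg hθ.le (hsqW W j₀)
  have h4 := mul_pos hθ hr
  linarith

end Slice

/-! ### Sub-root functions and localization -/

lemma IsSubRoot.le_sqrt_mul {ψ : ℝ → ℝ} (hψ : IsSubRoot ψ) {r s : ℝ} (hr : 0 < r) (hrs : r ≤ s) :
    ψ s ≤ √(s / r) * ψ r := by
  have hs : 0 < s := hr.trans_le hrs
  have h := hψ.anti (Set.mem_Ioi.2 hr) (Set.mem_Ioi.2 hs) hrs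
  simp only at h
  rw [div_le_iff₀ (Real.sqrt_pos.2 hs)] at h
  rw [Real.sqrt_div hs.le]
  calc ψ s ≤ ψ r / √r * √s := h
    _ = _ := by ring

/-- Above its fixed point `a`, a sub-root function satisfies `ψ r ≤ √(a r)`. -/
lemma IsSubRoot.sq_le {ψ : ℝ → ℝ} (hψ : IsSubRoot ψ) {a r : ℝ} (ha : IsFixedPointOf ψ a)
    (hr : 0 < r) (har : a ≤ r) : ψ r ^ 2 ≤ a * r := by
  have ha0 : 0 ≤ a := ha.1.1
  have hψr : 0 ≤ ψ r := hψ.nonneg r hr.le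
  by_contra! hcon
  -- By monotonicity the supremum of `S` is a fixed point, so every point of `S` is at most `a`.
  -- This also covers `a = 0`, where dividing by `√a` is impossible.
  set S : Set ℝ := {s | 0 ≤ s ∧ s ≤ ψ s} with hS
  have hbdd : BddAbove S := by
    refine ⟨max 1 (ψ 1 ^ 2), fun s hs => ?_⟩
    rcases le_total s 1 with h | h
    · exact h.trans (le_max_left _ _)
    · refine le_trans ?_ (le_max_right _ _)
      have h1 := hψ.le_sqrt_mul one_pos h
      rw [div_one] at h1
      have h2 : 0 < √s := Real.sqrt_pos.2 (by linarith)
      have h3 : √s ^ 2 = s := Real.sq_sqrt (by linarith)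
      have h4 : √s ≤ ψ 1 := by
        refine le_of_mul_le_mul_left ?_ h2
        have := hs.2
        nlinarith
      rw [← h3]
      exact pow_le_pow_left₀ h2.le h4 2
  have hup : ∀ s ∈ S, s ≤ a := by
    intro s hs
    set b := sSup S with hb
    have hsb : s ≤ b := le_csSup hbdd hs
    have hb0 : 0 ≤ b := hs.1.trans hsb
    have hbψ : b ≤ ψ b := by
      refine csSup_le ⟨s, hs⟩ fun t ht => ht.2.trans ?_
      exact hψ.mono (Set.mem_Ici.2 ht.1) (Set.mem_Ici.2 hb0) (le_csSup hbdd ht)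
    have hψb : ψ b ≤ b := by
      refine le_csSup hbdd ⟨hb0.trans hbψ, ?_⟩
      exact hψ.mono (Set.mem_Ici.2 hb0) (Set.mem_Ici.2 (hb0.trans hbψ)) hbψ
    exact hsb.trans (ha.2 ⟨hb0, le_antisymm hψb hbψ⟩)
  -- If `s ≤ r`, antitonicity of `ψ/√` gives `ψ s ≥ √s √s = s`, so `s ∈ S` although `s > a`.
  set s := ψ r ^ 2 / r with hs
  have has : a < s := by rw [hs, lt_div_iff₀ hr]; exact hcon
  have hs0 : 0 < s := ha0.trans_lt has
  rcases le_total s r with h | h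
  · refine absurd (hup s ⟨hs0.le, ?_⟩) (not_le.2 has)
    have h1 := hψ.le_sqrt_mul hs0 h
    have h2 : ψ r ^ 2 = s * r := by rw [hs]; field_simp
    have h3 : ψ r = √s * √r := by
      rw [← Real.sqrt_mul hs0.le, ← h2, Real.sqrt_sq hψr]
    rw [Real.sqrt_div hr.le, h3] at h1
    have hr' := Real.sqrt_pos.2 hr
    have hs' := Real.sqrt_pos.2 hs0
    have h4 : √s * √r * √s ≤ √r * ψ s := by
      rw [div_mul_eq_mul_div, le_div_iff₀ hs'] at h1
      exact h1
    have h5 : √s * √s = s := Real.mul_self_sqrt hs0.le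
    refine le_of_mul_le_mul_left (a := √r) ?_ hr'
    nlinarith
  · have h1 : r ≤ ψ r := by
      rw [hs, le_div_iff₀ hr] at h
      nlinarith
    have h2 := hup (ψ r) ⟨hψr, hψ.mono (Set.mem_Ici.2 hr.le) (Set.mem_Ici.2 hψr) h1⟩
    nlinarith

/-- The peeling bound: a downscaled value is at most a geometric sum of local suprema. -/
lemma scaled_le_sum_iSup {β : Type*} {D : Set β} {Φ τ : β → ℝ} {r : ℝ} (hr : 0 < r)
    {h₀ : β} (h₀D : h₀ ∈ D) (hτ₀ : τ h₀ ≤ 0) (hΦ₀ : Φ h₀ = 0)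
    (hb : BddAbove (Φ '' D)) {N : ℕ} {h : β} (hD : h ∈ D) (hN : τ h ≤ 4 ^ N * r)
    {p : ℝ} (hp0 : 0 ≤ p) (hp : p ≤ r / max r (τ h)) :
    p * Φ h ≤ ∑ i ∈ range (N + 1), 4 * (1 / 4 : ℝ) ^ i *
      ⨆ g : {g | g ∈ D ∧ τ g ≤ 4 ^ i * r}, Φ g := by
  have hb' : ∀ ρ : ℝ, BddAbove (Set.range fun g : {g | g ∈ D ∧ τ g ≤ ρ} => Φ g) := by
    intro ρ
    refine hb.mono ?_
    rintro _ ⟨g, rfl⟩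
    exact ⟨g, g.2.1, rfl⟩
  -- The zero deviation at `h₀` makes every local supremum nonnegative, so one shell may be bounded
  -- by the sum over all shells.
  have hG0 : ∀ i : ℕ, 0 ≤ ⨆ g : {g | g ∈ D ∧ τ g ≤ 4 ^ i * r}, Φ g := by
    intro i
    have := le_ciSup (hb' (4 ^ i * r)) ⟨h₀, h₀D, hτ₀.trans (by positivity)⟩
    simpa only [hΦ₀] using this
  have hterm : ∀ i ∈ range (N + 1), 0 ≤ 4 * (1 / 4 : ℝ) ^ i *
      ⨆ g : {g | g ∈ D ∧ τ g ≤ 4 ^ i * r}, Φ g := fun i _ => mul_nonneg (by positivity) (hG0 i)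
  rcases le_total (Φ h) 0 with hneg | hpos
  · exact (mul_nonpos_of_nonneg_of_nonpos hp0 hneg).trans (Finset.sum_nonneg hterm)
  have hex : ∃ i : ℕ, τ h ≤ 4 ^ i * r := ⟨N, hN⟩
  classical
  -- The first shell containing `h`. For `i = j + 1`, `τ h > 4^j r` makes the scaling factor at most
  -- `4^{-j} = 4 · 4^{-i}`.
  set i := Nat.find hex with hi
  have hiτ : τ h ≤ 4 ^ i * r := Nat.find_spec hex
  have hiN : i ≤ N := Nat.find_min' hex hN
  refine le_trans ?_ (Finset.single_le_sum hterm (Finset.mem_range.2 (Nat.lt_succ_of_le hiN)))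
  have hsup : Φ h ≤ ⨆ g : {g | g ∈ D ∧ τ g ≤ 4 ^ i * r}, Φ g :=
    le_ciSup (hb' (4 ^ i * r)) ⟨h, hD, hiτ⟩
  refine mul_le_mul (hp.trans ?_) hsup hpos (by positivity)
  rcases Nat.eq_zero_or_pos i with h0 | h0
  · rw [h0, pow_zero, mul_one]
    refine (div_le_one_of_le₀ (le_max_left _ _) (hr.le.trans (le_max_left _ _))).trans (by norm_num)
  · obtain ⟨j, hj⟩ : ∃ j, i = j + 1 := ⟨i - 1, by omega⟩
    have hlt : 4 ^ j * r < τ h := by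
      have := Nat.find_min hex (m := j) (by omega)
      exact not_le.1 this
    have h4 : (0 : ℝ) < 4 ^ j := by positivity
    rw [hj, pow_succ, one_div, inv_pow]
    have : 4 * ((4 ^ j)⁻¹ * (4 : ℝ)⁻¹) = (4 ^ j)⁻¹ := by ring
    rw [this, div_le_iff₀ (hr.trans_le (le_max_left _ _)), ← div_eq_inv_mul, le_div_iff₀ h4]
    have := le_max_right r (τ h)
    linarith

lemma sum_geometric_peel {ψ : ℝ → ℝ} (hψ : IsSubRoot ψ) {r : ℝ} (hr : 0 < r) (N : ℕ) :
    ∑ i ∈ range (N + 1), 4 * (1 / 4 : ℝ) ^ i * ψ (4 ^ i * r) ≤ 8 * ψ r := by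
  have hψr := hψ.nonneg r hr.le
  have h1 : ∀ i ∈ range (N + 1), 4 * (1 / 4 : ℝ) ^ i * ψ (4 ^ i * r)
      ≤ 4 * ψ r * (1 / 2 : ℝ) ^ i := by
    intro i _
    have h4 : (1 : ℝ) ≤ 4 ^ i := one_le_pow₀ (by norm_num)
    have h2 := hψ.le_sqrt_mul hr (s := 4 ^ i * r) (by nlinarith)
    have h3 : √(4 ^ i * r / r) = 2 ^ i := by
      rw [mul_div_cancel_right₀ _ hr.ne', show (4 : ℝ) = 2 ^ 2 by norm_num, ← pow_mul,
        mul_comm 2 i, pow_mul]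
      exact Real.sqrt_sq (by positivity)
    rw [h3] at h2
    calc 4 * (1 / 4 : ℝ) ^ i * ψ (4 ^ i * r) ≤ 4 * (1 / 4 : ℝ) ^ i * (2 ^ i * ψ r) :=
          mul_le_mul_of_nonneg_left h2 (by positivity)
      _ = 4 * ψ r * ((1 / 4) ^ i * 2 ^ i) := by ring
      _ = _ := by rw [← mul_pow]; norm_num
  refine (Finset.sum_le_sum h1).trans ?_
  rw [← Finset.mul_sum]
  have h2 : ∑ i ∈ range (N + 1), (1 / 2 : ℝ) ^ i ≤ 2 := sum_geometric_two_le _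
  nlinarith

/-! ### Localized deviations on slices. -/

section Slice

variable {α : Type*}

/-- Peeling is applied for each `W` and then averaged. The bound `T` serves only to make the number
of shells finite; the sub-root growth `ψ(4^i r) ≤ 2^i ψ(r)` makes the result independent of that
number. -/
lemma sliceMean_scaled_le {β : Type*} {s : Finset α} {k : ℕ}
    {D : Set β} {v : β → α → ℝ} {L : ℝ} (hL : ∀ h ∈ D, ∀ i, |v h i| ≤ L)
    {τ : β → ℝ} {T : ℝ} (hT : ∀ h ∈ D, τ h ≤ T) {h₀ : β} (h₀D : h₀ ∈ D) (hτ₀ : τ h₀ ≤ 0)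
    (hv₀ : ∀ i, v h₀ i = 0) {ψ : ℝ → ℝ} (hψ : IsSubRoot ψ) {r : ℝ} (hr : 0 < r)
    (hE : ∀ ρ, r ≤ ρ →
      sliceMean s k (fun W => ⨆ h : {h | h ∈ D ∧ τ h ≤ ρ}, sliceDev s k W (v h)) ≤ ψ ρ)
    {p : β → ℝ} (hp0 : ∀ h, 0 ≤ p h) (hp : ∀ h, p h ≤ r / max r (τ h)) :
    sliceMean s k (fun W => ⨆ h : D, sliceDev s k W (fun i => p h * v h i)) ≤ 8 * ψ r := by
  have : Nonempty D := ⟨⟨h₀, h₀D⟩⟩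
  obtain ⟨N, hN⟩ : ∃ N : ℕ, T ≤ 4 ^ N * r := by
    obtain ⟨N, hN⟩ := pow_unbounded_of_one_lt (T / r) (by norm_num : (1 : ℝ) < 4)
    exact ⟨N, ((div_lt_iff₀ hr).1 hN).le⟩
  have hb : ∀ W : Finset α, BddAbove ((fun h => sliceDev s k W (v h)) '' D) := by
    intro W
    obtain ⟨B, hB⟩ := bddAbove_range_sliceDev s k W (v := fun h : D => v h)
      (fun h i => hL h h.2 i)
    refine ⟨B, ?_⟩
    rintro _ ⟨h, hh, rfl⟩
    exact hB ⟨⟨h, hh⟩, rfl⟩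
  calc sliceMean s k (fun W => ⨆ h : D, sliceDev s k W (fun i => p h * v h i))
      ≤ sliceMean s k (fun W => ∑ i ∈ range (N + 1), 4 * (1 / 4 : ℝ) ^ i *
          ⨆ g : {g | g ∈ D ∧ τ g ≤ 4 ^ i * r}, sliceDev s k W (v g)) := by
        refine sliceMean_le fun W _ => ciSup_le fun h => ?_
        rw [sliceDev_smul]
        exact scaled_le_sum_iSup (Φ := fun g => sliceDev s k W (v g)) hr h₀D hτ₀
          (by simp [sliceDev, hv₀]) (hb W) h.2 ((hT h h.2).trans hN) (hp0 h) (hp h)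
    _ = ∑ i ∈ range (N + 1), 4 * (1 / 4 : ℝ) ^ i * sliceMean s k (fun W =>
          ⨆ g : {g | g ∈ D ∧ τ g ≤ 4 ^ i * r}, sliceDev s k W (v g)) := by
        rw [sliceMean_sum]
        exact Finset.sum_congr rfl fun i _ => sliceMean_const_mul _ _ _ _
    _ ≤ ∑ i ∈ range (N + 1), 4 * (1 / 4 : ℝ) ^ i * ψ (4 ^ i * r) := by
        refine Finset.sum_le_sum fun i _ => mul_le_mul_of_nonneg_left (hE _ ?_) (by positivity)
        have h4 : (1 : ℝ) ≤ 4 ^ i := one_le_pow₀ (by norm_num)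
        nlinarith
    _ ≤ 8 * ψ r := sum_geometric_peel hψ hr N

/-- The factor of `x / k` in the localization radius. -/
noncomputable def radiusConst (K L : ℝ) : ℝ :=
  64 * K * (32 * K) * (16 + 8 * (1 / (32 * K)) ^ 2 * L ^ 2)

lemma radiusConst_pos {K : ℝ} (hK : 0 < K) (L : ℝ) : 0 < radiusConst K L := by
  unfold radiusConst; positivity

/-- The localized uniform deviation bound for a uniform random `k`-subset. -/
theorem card_exists_localized_gt_le [DecidableEq α] {β : Type*} {s : Finset α} {k : ℕ}
    (hk0 : 1 ≤ k) (hk : k ≤ #s) {D : Set β} {v : β → α → ℝ} {L : ℝ}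
    (hL : ∀ h ∈ D, ∀ i, |v h i| ≤ L) {τ : β → ℝ} {T : ℝ} (hT : ∀ h ∈ D, τ h ≤ T)
    (hvar : ∀ h ∈ D, 1 / (#s : ℝ) * ∑ i ∈ s, v h i ^ 2 ≤ τ h)
    {h₀ : β} (h₀D : h₀ ∈ D) (hτ₀ : τ h₀ ≤ 0) (hv₀ : ∀ i, v h₀ i = 0)
    {ψ : ℝ → ℝ} (hψ : IsSubRoot ψ) {a : ℝ} (ha : IsFixedPointOf ψ a)
    (hE : ∀ ρ, a ≤ ρ →
      sliceMean s k (fun W => ⨆ h : {h | h ∈ D ∧ τ h ≤ ρ}, sliceDev s k W (v h)) ≤ ψ ρ)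
    (hE2 : ∀ ρ, a ≤ ρ →
      sliceMean s k (fun W => ⨆ h : {h | h ∈ D ∧ τ h ≤ ρ},
        sliceDev s k W (fun i => v h i ^ 2)) ≤ ψ ρ)
    {K : ℝ} (hK : 1 < K) {x : ℝ} (hx : 0 < x) :
    ∃ Bad : Finset (Finset α), (#Bad : ℝ) ≤ Real.exp (-x) * ((#s).choose k : ℝ) ∧
      ∀ W ∈ s.powersetCard k, W ∉ Bad → ∀ h ∈ D, sliceDev s k W (v h)
        ≤ (τ h + (65536 * K ^ 2 * a + radiusConst K L * x / k)) / (2 * K) := by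
  have hkp : (0 : ℝ) < k := by exact_mod_cast hk0
  have hK0 : 0 < K := by linarith
  have ha0 : 0 ≤ a := ha.1.1
  have hbp := radiusConst_pos hK0 L
  set b := radiusConst K L with hb
  set r := 65536 * K ^ 2 * a + b * x / k with hr
  have hbx : 0 < b * x / k := by positivity
  have hKa : a ≤ 65536 * K ^ 2 * a := by
    refine le_mul_of_one_le_left ha0 ?_
    nlinarith
  have hrp : 0 < r := by linarith
  have har : a ≤ r := by linarith
  -- Here `65536 = 256²`: `ψ(r)² ≤ a r ≤ r² / (256 K)²`.
  have hψr : ψ r ≤ r / (256 * K) := by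
    have h1 := hψ.sq_le ha hrp har
    rw [le_div_iff₀ (by positivity)]
    refine le_of_sq_le_sq ?_ hrp.le
    have h2 : 65536 * K ^ 2 * a ≤ r := by linarith
    nlinarith [mul_le_mul_of_nonneg_right h2 hrp.le, sq_nonneg K]
  have hψ0 : 0 ≤ ψ r := hψ.nonneg r hrp.le
  set θ := 1 / (32 * K) with hθ
  have hθp : 0 < θ := by positivity
  have hθ1 : θ ≤ 1 := by
    rw [hθ, div_le_one (by positivity)]; linarith
  set q : β → ℝ := fun h => r / max r (τ h) with hq
  have hmaxp : ∀ h, 0 < max r (τ h) := fun h => hrp.trans_le (le_max_left _ _)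
  have hq0 : ∀ h, 0 < q h := fun h => div_pos hrp (hmaxp h)
  have hq1 : ∀ h, q h ≤ 1 := fun h => div_le_one_of_le₀ (le_max_left _ _) (hmaxp h).le
  have hqsq : ∀ h, q h ^ 2 ≤ q h := fun h => by nlinarith [hq0 h, hq1 h]
  set w : D → α → ℝ := fun h i => q h * v h i with hw
  have hwL : ∀ h i, |w h i| ≤ L := by
    intro h i
    simp only [hw]
    rw [abs_mul, abs_of_pos (hq0 h)]
    have h1 := hL h h.2 i
    nlinarith [abs_nonneg (v h i), hq1 h]
  have hwvar : ∀ h, 1 / (#s : ℝ) * ∑ i ∈ s, w h i ^ 2 ≤ r := by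
    intro h
    have h1 : 1 / (#s : ℝ) * ∑ i ∈ s, w h i ^ 2
        = q h ^ 2 * (1 / (#s : ℝ) * ∑ i ∈ s, v h i ^ 2) := by
      simp only [hw, mul_pow, ← Finset.mul_sum]; ring
    have h0 : 0 ≤ 1 / (#s : ℝ) * ∑ i ∈ s, v h i ^ 2 :=
      mul_nonneg (by positivity) (Finset.sum_nonneg fun _ _ => sq_nonneg _)
    have h2 := (hvar h h.2).trans (le_max_right r (τ h))
    rw [h1]
    calc q h ^ 2 * (1 / (#s : ℝ) * ∑ i ∈ s, v h i ^ 2)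
        ≤ q h * max r (τ h) := mul_le_mul (hqsq h) h2 h0 (hq0 h).le
      _ = r := div_mul_cancel₀ _ (hmaxp h).ne'
  have hE1' := sliceMean_scaled_le hL hT h₀D hτ₀ hv₀ hψ hrp
    (fun ρ hρ => hE ρ (har.trans hρ)) (p := q) (fun h => (hq0 h).le) (fun h => le_rfl)
  -- The squares carry the factor `q²`, which is at most `q`, so the same peeling applies.
  have hE2' := sliceMean_scaled_le (v := fun h i => v h i ^ 2) (L := L ^ 2)
    (fun h hh i => by
      rw [abs_pow]; exact pow_le_pow_left₀ (abs_nonneg _) (hL h hh i) 2)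
    hT h₀D hτ₀ (fun i => by simp [hv₀]) hψ hrp
    (fun ρ hρ => hE2 ρ (har.trans hρ)) (p := fun h => q h ^ 2) (fun h => sq_nonneg _) hqsq
  obtain ⟨Bad, hBad, hgood⟩ := card_exists_sliceDev_gt_le hk0 hk hθp hrp hwL hwvar
    (j₀ := ⟨h₀, h₀D⟩) (fun i => by simp [hw, hv₀]) hx
  refine ⟨Bad, hBad, fun W hW hWB h hh => ?_⟩
  have h1 := hgood W hW hWB ⟨h, hh⟩
  have h2 : sliceDev s k W (w ⟨h, hh⟩) = q h * sliceDev s k W (v h) := sliceDev_smul _ _ _ _ _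
  have h3 : sliceMean s k (fun W => ⨆ j, sliceDev s k W (fun i => w j i ^ 2)) ≤ 8 * ψ r := by
    refine le_trans (le_of_eq ?_) hE2'
    simp only [hw, mul_pow]
  rw [h2] at h1
  have h4 : 2 * θ * sliceMean s k (fun W => ⨆ j, sliceDev s k W (fun i => w j i ^ 2))
      ≤ 2 * (8 * ψ r) := by
    have h5 := mul_le_mul_of_nonneg_left h3 hθp.le
    have h6 : θ * (8 * ψ r) ≤ 1 * (8 * ψ r) := mul_le_mul_of_nonneg_right hθ1 (by linarith)
    linarith
  have h5 : 4 * θ * r = r / (8 * K) := by rw [hθ]; field_simp; ring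
  have h6 : 8 * ((16 + 8 * θ ^ 2 * L ^ 2) / (θ * k)) * x = b * x / k / (8 * K) := by
    rw [hb, radiusConst, ← hθ]
    have : 32 * K = 1 / θ := by rw [hθ]; field_simp
    rw [this]
    field_simp
    ring
  have h7 : 32 * ψ r ≤ r / (8 * K) := by
    have : r / (256 * K) * 32 = r / (8 * K) := by field_simp; ring
    linarith
  have h8 : b * x / k / (8 * K) ≤ r / (8 * K) :=
    div_le_div_of_nonneg_right (by nlinarith) (by positivity)
  -- The expected suprema, the term `4 θ r` and the tail term each contribute at most `r / (8K)`.
  have h9 : q h * sliceDev s k W (v h) ≤ r / (2 * K) := by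
    have : r / (8 * K) + r / (8 * K) + r / (8 * K) ≤ r / (2 * K) := by
      have e : r / (2 * K) = 4 * (r / (8 * K)) := by field_simp; ring
      have : 0 ≤ r / (8 * K) := by positivity
      linarith
    linarith
  have h10 : sliceDev s k W (v h) ≤ max r (τ h) / (2 * K) := by
    refine le_of_mul_le_mul_left (h9.trans (le_of_eq ?_)) (hq0 h)
    simp only [hq]
    have := (hmaxp h).ne'
    field_simp
  refine h10.trans (div_le_div_of_nonneg_right ?_ (by positivity))
  have hτ0 : 0 ≤ τ h := le_trans (mul_nonneg (by positivity)
    (Finset.sum_nonneg fun _ _ => sq_nonneg _)) (hvar h hh)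
  exact max_le (by linarith) (by linarith)

end Slice

/-! ### The law of the test set -/

/-- Round `k` swaps positions `k` and `d_k ≥ k`, so earlier positions stay frozen and the initial
entries of the array record the output. -/
lemma permArray_apply_castAdd {u m : ℕ} {d : Fin u → Fin (u + m)}
    (hd : ∀ i, Fin.castAdd m i ≤ d i) (i : Fin u) {k : ℕ} (hik : (i : ℕ) + 1 ≤ k) (hk : k ≤ u) :
    permArray d k (Fin.castAdd m i) = drawnIndex d i := by
  induction k, hik using Nat.le_induction with
  | base =>
    rw [permArray, dif_pos i.2]
    simp [drawnIndex]
  | succ k hik ih =>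
    rw [permArray, dif_pos (by omega), Equiv.Perm.mul_apply, Equiv.swap_apply_of_ne_of_ne,
      ih (by omega)]
    · intro h
      have := congrArg Fin.val h
      simp at this
      omega
    · intro h
      have h1 := hd ⟨k, by omega⟩
      rw [← h, Fin.le_def] at h1
      simp at h1
      omega

lemma drawnIndex_injective {u m : ℕ} {d : Fin u → Fin (u + m)}
    (hd : ∀ i, Fin.castAdd m i ≤ d i) : Function.Injective (drawnIndex d) := by
  intro i j hij
  rw [← permArray_apply_castAdd hd i i.2 le_rfl, ← permArray_apply_castAdd hd j j.2 le_rfl] at hij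
  exact Fin.castAdd_injective u m ((permArray d u).injective hij)

/-- The array before round `i` depends only on the earlier draws, so the draws can be recovered one
at a time from the output. -/
lemma drawnIndex_left_injective {u m : ℕ} :
    Function.Injective (drawnIndex : (Fin u → Fin (u + m)) → Fin u → Fin (u + m)) := by
  intro d d' h
  have key : ∀ k ≤ u, permArray d k = permArray d' k := by
    intro k
    induction k with
    | zero => intro _; rfl
    | succ k ih =>
      intro hk
      have h1 := ih (by omega)
      have h2 := congrFun h ⟨k, by omega⟩
      simp only [drawnIndex] at h2
      rw [h1] at h2
      rw [permArray, permArray, dif_pos (by omega), dif_pos (by omega), h1,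
        (permArray d' k).injective h2]
  funext i
  have h2 := congrFun h i
  simp only [drawnIndex] at h2
  rw [key i i.2.le] at h2
  exact (permArray d' i).injective h2

/-- The vectors that RANDPERM can draw. -/
def drawSupport (u m : ℕ) : Finset (Fin u → Fin (u + m)) :=
  Fintype.piFinset fun i => Finset.Ici (Fin.castAdd m i)

lemma mem_drawSupport {u m : ℕ} {d : Fin u → Fin (u + m)} :
    d ∈ drawSupport u m ↔ ∀ i, Fin.castAdd m i ≤ d i := by
  simp [drawSupport]

lemma drawLaw_eq_uniformOn (u m : ℕ) : drawLaw u m = uniformOn (drawSupport u m : Set _) := by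
  have : (drawSupport u m : Set (Fin u → Fin (u + m)))
      = Set.univ.pi fun i => Set.Ici (Fin.castAdd m i) := by
    ext d; simp only [Finset.mem_coe, mem_drawSupport, Set.mem_univ_pi, Set.mem_Ici]
  rw [this, uniformOn_pi, drawLaw]

lemma drawSupport_nonempty (u m : ℕ) : (drawSupport u m).Nonempty :=
  ⟨fun i => Fin.castAdd m i, mem_drawSupport.2 fun _ => le_rfl⟩

instance isProbabilityMeasure_drawLaw (u m : ℕ) : IsProbabilityMeasure (drawLaw u m) := by
  rw [drawLaw_eq_uniformOn]
  exact isProbabilityMeasure_uniformOn (Finset.finite_toSet _) (drawSupport_nonempty u m)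

lemma integral_drawLaw {u m : ℕ} (f : (Fin u → Fin (u + m)) → ℝ) :
    ∫ d, f d ∂drawLaw u m = (∑ d ∈ drawSupport u m, f d) / #(drawSupport u m) := by
  rw [integral_fintype (Integrable.of_finite), drawLaw_eq_uniformOn, Finset.sum_div,
    ← Finset.sum_subset (Finset.subset_univ (drawSupport u m))]
  · refine Finset.sum_congr rfl fun d hd => ?_
    rw [measureReal_def, ← Finset.coe_singleton, uniformOn_apply_finset,
      Finset.inter_singleton_of_mem hd]
    simp
    ring
  · intro d _ hd
    rw [measureReal_def, ← Finset.coe_singleton, uniformOn_apply_finset,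
      Finset.inter_singleton_of_notMem hd]
    simp

lemma card_drawSupport (u m : ℕ) : #(drawSupport u m) = (u + m).descFactorial u := by
  rw [drawSupport, Fintype.card_piFinset, Nat.descFactorial_eq_prod_range,
    ← Fin.prod_univ_eq_prod_range]
  refine Finset.prod_congr rfl fun i _ => ?_
  simp

lemma testSet_mem_powersetCard {u m : ℕ} {d : Fin u → Fin (u + m)} (hd : d ∈ drawSupport u m) :
    testSet d ∈ (univ : Finset (Fin (u + m))).powersetCard u := by
  rw [Finset.mem_powersetCard, testSet,
    Finset.card_image_of_injective _ (drawnIndex_injective (mem_drawSupport.1 hd))]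
  simp

lemma trainSet_mem_powersetCard {u m : ℕ} {d : Fin u → Fin (u + m)} (hd : d ∈ drawSupport u m) :
    trainSet d ∈ (univ : Finset (Fin (u + m))).powersetCard m := by
  have h := (Finset.mem_powersetCard.1 (testSet_mem_powersetCard hd)).2
  rw [Finset.mem_powersetCard, trainSet, Finset.card_compl, h, Fintype.card_fin]
  exact ⟨Finset.subset_univ _, by omega⟩

/-- The output map from admissible draws to embeddings is injective between sets of the same size `n
(n-1) ⋯ (n-u+1)`, hence bijective. -/
lemma sum_drawSupport_eq_sum_embedding {u m : ℕ} (f : Finset (Fin (u + m)) → ℝ) :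
    ∑ d ∈ drawSupport u m, f (testSet d) = ∑ e : Fin u ↪ Fin (u + m), f (univ.map e) := by
  have hinj : Function.Injective (fun d : drawSupport u m =>
      (⟨drawnIndex d.1, drawnIndex_injective (mem_drawSupport.1 d.2)⟩ :
        Fin u ↪ Fin (u + m))) := by
    intro d d' h
    exact Subtype.ext (drawnIndex_left_injective (congrArg DFunLike.coe h))
  have hbij := (Fintype.bijective_iff_injective_and_card _).2 ⟨hinj, by
    rw [Fintype.card_coe, card_drawSupport, Fintype.card_embedding_eq, Fintype.card_fin,
      Fintype.card_fin]⟩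
  rw [← Finset.sum_coe_sort]
  refine Fintype.sum_bijective _ hbij _ _ fun d => ?_
  congr 1
  rw [testSet, Finset.map_eq_image]
  rfl

lemma card_embedding_fiber_eq {u n : ℕ} {W W' : Finset (Fin n)} (h : #W = #W') :
    #{e : Fin u ↪ Fin n | univ.map e = W} = #{e : Fin u ↪ Fin n | univ.map e = W'} := by
  obtain ⟨σ, hσ⟩ := Equiv.Perm.exists_map_finset_eq W W' h
  refine Finset.card_bij' (fun e _ => e.trans σ.toEmbedding)
    (fun e _ => e.trans σ.symm.toEmbedding) ?_ ?_ ?_ ?_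
  · intro e he
    rw [Finset.mem_filter] at he ⊢
    refine ⟨Finset.mem_univ _, ?_⟩
    rw [← Finset.map_map, he.2, hσ]
  · intro e he
    rw [Finset.mem_filter] at he ⊢
    refine ⟨Finset.mem_univ _, ?_⟩
    rw [← Finset.map_map, he.2, ← hσ, Finset.map_map]
    ext x; simp
  · intro e _; ext x; simp
  · intro e _; ext x; simp

/-- The test set is a uniform random `u`-subset. -/
theorem integral_testSet {u m : ℕ} (f : Finset (Fin (u + m)) → ℝ) :
    ∫ d, f (testSet d) ∂drawLaw u m = sliceMean univ u f := by
  obtain ⟨W₀, hW₀⟩ : ((univ : Finset (Fin (u + m))).powersetCard u).Nonempty :=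
    Finset.powersetCard_nonempty.2 (by simp)
  set C : ℝ := (#{e : Fin u ↪ Fin (u + m) | univ.map e = W₀} : ℝ) with hC
  have hsum : ∀ g : Finset (Fin (u + m)) → ℝ, ∑ d ∈ drawSupport u m, g (testSet d)
      = C * ∑ W ∈ (univ : Finset (Fin (u + m))).powersetCard u, g W := by
    intro g
    rw [sum_drawSupport_eq_sum_embedding, ← Finset.sum_fiberwise_of_maps_to
      (s := univ) (t := (univ : Finset (Fin (u + m))).powersetCard u)
      (g := fun e : Fin u ↪ Fin (u + m) => univ.map e), Finset.mul_sum]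
    · refine Finset.sum_congr rfl fun W hW => ?_
      rw [Finset.sum_congr rfl (g := fun _ => g W) fun e he => by
          rw [(Finset.mem_filter.1 he).2], Finset.sum_const, nsmul_eq_mul, hC,
        card_embedding_fiber_eq (((Finset.mem_powersetCard.1 hW).2).trans
          (Finset.mem_powersetCard.1 hW₀).2.symm)]
    · intro e _
      simp [Finset.mem_powersetCard]
  -- The constant function 1 normalizes the sum, so the fiber size `C` cancels without being
  -- computed.
  have hone := hsum fun _ => 1
  simp only [Finset.sum_const, nsmul_eq_mul, mul_one, Finset.card_powersetCard] at hone
  have hpos : (0 : ℝ) < #(drawSupport u m) := by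
    exact_mod_cast (drawSupport_nonempty u m).card_pos
  rw [integral_drawLaw, hsum, hone, sliceMean]
  have hC0 : C ≠ 0 := by
    intro h
    rw [hone, h, zero_mul] at hpos
    exact lt_irrefl _ hpos
  rw [mul_div_mul_left _ _ hC0]

/-- The training set is a uniform random `m`-subset. -/
theorem integral_trainSet {u m : ℕ} (f : Finset (Fin (u + m)) → ℝ) :
    ∫ d, f (trainSet d) ∂drawLaw u m = sliceMean univ m f := by
  have h := integral_testSet (u := u) (m := m) fun W => f Wᶜ
  simp only [trainSet]
  rw [h, sliceMean, sliceMean]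
  congr 1
  · refine Finset.sum_bij' (fun W _ => Wᶜ) (fun W _ => Wᶜ) ?_ ?_ ?_ ?_ ?_
    · intro W hW
      have := (Finset.mem_powersetCard.1 hW).2
      rw [Finset.mem_powersetCard, Finset.card_compl, this, Fintype.card_fin]
      exact ⟨Finset.subset_univ _, by omega⟩
    · intro W hW
      have := (Finset.mem_powersetCard.1 hW).2
      rw [Finset.mem_powersetCard, Finset.card_compl, this, Fintype.card_fin]
      exact ⟨Finset.subset_univ _, by omega⟩
    · intro W _; exact compl_compl W
    · intro W _; exact compl_compl W
    · intro W _; rfl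
  · rw [Finset.card_univ, Fintype.card_fin, Nat.choose_symm_add]

/-- Uniform random sets avoid a small family with large probability. -/
lemma le_real_of_integral_eq {u m k : ℕ} {A : (Fin u → Fin (u + m)) → Finset (Fin (u + m))}
    (hA : ∀ f : Finset (Fin (u + m)) → ℝ, ∫ d, f (A d) ∂drawLaw u m = sliceMean univ k f)
    (hk : k ≤ u + m) {Bad : Finset (Finset (Fin (u + m)))} {p : ℝ}
    (hBad : (#Bad : ℝ) ≤ p * ((#(univ : Finset (Fin (u + m)))).choose k : ℝ))
    {E : Set (Fin u → Fin (u + m))} (hE : ∀ d ∈ drawSupport u m, A d ∉ Bad → d ∈ E) :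
    1 - p ≤ (drawLaw u m).real E := by
  have hN : (0 : ℝ) < ((#(univ : Finset (Fin (u + m)))).choose k : ℝ) := by
    rw [Finset.card_univ, Fintype.card_fin]
    exact_mod_cast Nat.choose_pos hk
  classical
  have h1 : ∫ d, (if A d ∈ Bad then (1 : ℝ) else 0) ∂drawLaw u m ≤ p := by
    rw [hA fun W => if W ∈ Bad then (1 : ℝ) else 0, sliceMean, div_le_iff₀ hN]
    refine le_trans ?_ hBad
    rw [Finset.sum_boole]
    exact Nat.cast_le.2 (Finset.card_le_card fun W hW => (Finset.mem_filter.1 hW).2)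
  have h2 : (drawLaw u m).real E = ∫ d, E.indicator (fun _ => (1 : ℝ)) d ∂drawLaw u m := by
    rw [← integral_indicator_one (Set.toFinite E).measurableSet]; rfl
  have h3 : 1 - (drawLaw u m).real E
      ≤ ∫ d, (if A d ∈ Bad then (1 : ℝ) else 0) ∂drawLaw u m := by
    have hpos : (0 : ℝ) < #(drawSupport u m) := by
      exact_mod_cast (drawSupport_nonempty u m).card_pos
    rw [h2, integral_drawLaw, integral_drawLaw, sub_le_iff_le_add, ← add_div, le_div_iff₀ hpos,
      one_mul, ← Finset.sum_add_distrib, Finset.cast_card]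
    refine Finset.sum_le_sum fun d hd => ?_
    by_cases hb : A d ∈ Bad
    · rw [if_pos hb]
      have := Set.indicator_nonneg (s := E) (f := fun _ => (1 : ℝ)) (fun _ _ => zero_le_one) d
      linarith
    · rw [if_neg hb, Set.indicator_of_mem (hE d hd hb)]
      simp
  linarith

/-! ### Deviations of the test and the training loss -/

section Loss

variable {α : Type*} {u m : ℕ}

/-- `testDev` sums over draws and `sliceDev` over the set drawn; admissibility of `d` excludes
repetitions. -/
lemma testDev_eq_sliceDev {d : Fin u → Fin (u + m)} (hd : d ∈ drawSupport u m)
    (S : Fin (u + m) → α) (h : α → ℝ) :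
    testDev S d h = sliceDev univ u (testSet d) (fun i => h (S i)) := by
  unfold testDev sliceDev avgLoss
  rw [testSet, Finset.sum_image (drawnIndex_injective (mem_drawSupport.1 hd)).injOn,
    Finset.card_univ, Fintype.card_fin]

lemma trainDev_eq_sliceDev (d : Fin u → Fin (u + m)) (S : Fin (u + m) → α) (h : α → ℝ) :
    trainDev S d h = sliceDev univ m (trainSet d) (fun i => h (S i)) := by
  unfold trainDev sliceDev avgLoss trainLoss
  rw [Finset.card_univ, Fintype.card_fin]

lemma sliceDev_neg {β : Type*} (s : Finset β) (k : ℕ) (W : Finset β) (v : β → ℝ) :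
    sliceDev s k W (fun i => -v i) = -sliceDev s k W v := by
  simpa using sliceDev_smul s k W (-1) v

lemma expSup_testDev {β : Type*} (H : Set β) (S : Fin (u + m) → α) (Q : β → α → ℝ) :
    expSup u m H (fun d h => testDev S d (Q h))
      = sliceMean univ u (fun W => ⨆ h : H, sliceDev univ u W (fun i => Q h (S i))) := by
  rw [← integral_testSet, expSup, integral_drawLaw, integral_drawLaw]
  congr 1
  refine Finset.sum_congr rfl fun d hd => ?_
  simp only [testDev_eq_sliceDev hd]

lemma expSup_trainDev {β : Type*} (H : Set β) (S : Fin (u + m) → α) (Q : β → α → ℝ) :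
    expSup u m H (fun d h => trainDev S d (Q h))
      = sliceMean univ m (fun W => ⨆ h : H, sliceDev univ m W (fun i => Q h (S i))) := by
  rw [← integral_trainSet, expSup]
  simp only [trainDev_eq_sliceDev]

lemma expSup_neg_trainDev {β : Type*} (H : Set β) (S : Fin (u + m) → α) (Q : β → α → ℝ) :
    expSup u m H (fun d h => -trainDev S d (Q h))
      = sliceMean univ m (fun W => ⨆ h : H, sliceDev univ m W (fun i => -Q h (S i))) := by
  rw [← integral_trainSet, expSup]
  simp only [trainDev_eq_sliceDev, sliceDev_neg]

/-- If the smaller part of a sample exceeds the average by at most `ρ`, it exceeds the average of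
the other part by at most `2 ρ`. -/
lemma avg_sub_avg_le {k l : ℝ} (hk : 0 < k) (hkl : k ≤ l) {A B ρ : ℝ} (hρ : 0 ≤ ρ)
    (h : 1 / k * A - 1 / (k + l) * (A + B) ≤ ρ) : 1 / k * A - 1 / l * B ≤ 2 * ρ := by
  have hl : 0 < l := hk.trans_le hkl
  have e : 1 / k * A - 1 / (k + l) * (A + B) = l / (k + l) * (1 / k * A - 1 / l * B) := by
    field_simp
    ring
  rw [e] at h
  have h1 : 1 / 2 ≤ l / (k + l) := by
    rw [div_le_div_iff₀ (by norm_num) (by positivity)]; linarith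
  rcases le_total (1 / k * A - 1 / l * B) 0 with h0 | h0
  · linarith
  · nlinarith

lemma testLoss_sub_trainLoss_le_of_test {d : Fin u → Fin (u + m)} (hu : 1 ≤ u) (hum : u ≤ m)
    (S : Fin (u + m) → α) (h : α → ℝ) {ρ : ℝ} (hρ : 0 ≤ ρ)
    (hdev : sliceDev univ u (testSet d) (fun i => h (S i)) ≤ ρ) :
    testLoss S d h - trainLoss S d h ≤ 2 * ρ := by
  refine avg_sub_avg_le (by exact_mod_cast hu) (by exact_mod_cast hum) hρ ?_
  rw [sliceDev, Finset.card_univ, Fintype.card_fin] at hdev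
  rw [trainSet, Finset.sum_add_sum_compl]
  push_cast at hdev
  exact hdev

lemma testLoss_sub_trainLoss_le_of_train {d : Fin u → Fin (u + m)} (hm : 1 ≤ m) (hmu : m ≤ u)
    (S : Fin (u + m) → α) (h : α → ℝ) {ρ : ℝ} (hρ : 0 ≤ ρ)
    (hdev : sliceDev univ m (trainSet d) (fun i => -h (S i)) ≤ ρ) :
    testLoss S d h - trainLoss S d h ≤ 2 * ρ := by
  have key := avg_sub_avg_le (k := (m : ℝ)) (l := (u : ℝ)) (A := -∑ i ∈ trainSet d, h (S i))
    (B := -∑ i ∈ testSet d, h (S i)) (by exact_mod_cast hm) (by exact_mod_cast hmu) hρ ?_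
  · unfold testLoss trainLoss
    linarith
  · rw [sliceDev_neg, sliceDev, Finset.card_univ, Fintype.card_fin] at hdev
    have h1 := Finset.sum_add_sum_compl (testSet d) fun i => h (S i)
    rw [← trainSet] at h1
    rw [← h1] at hdev
    push_cast at hdev
    rw [add_comm (m : ℝ)]
    linarith

end Loss

/-! ### Loss differences and their surrogate variance. -/

section LossClass

variable {X Y : Type*} {n : ℕ} {ℓ : ℝ → Y → ℝ} {F : Set (X → ℝ)} {S : Fin n → X × Y}
  {fstar : X → ℝ} {B : ℝ}

lemma avgLoss_nonneg_of_mainAssumption (hM : MainAssumption ℓ F S fstar B) {f : X → ℝ}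
    (hf : f ∈ F) : 0 ≤ B * avgLoss S (lossFun ℓ f - lossFun ℓ fstar) := by
  refine le_trans ?_ (hM.sq_le f hf)
  exact mul_nonneg (by positivity) (Finset.sum_nonneg fun _ _ => sq_nonneg _)

lemma surrogateVar_le (hM : MainAssumption ℓ F S fstar B) {f₁ f₂ : X → ℝ} (hf₁ : f₁ ∈ F)
    (hf₂ : f₂ ∈ F) : surrogateVar ℓ F S fstar B (lossFun ℓ f₁ - lossFun ℓ f₂)
      ≤ 2 * B * avgLoss S (lossFun ℓ f₁ - lossFun ℓ fstar)
        + 2 * B * avgLoss S (lossFun ℓ f₂ - lossFun ℓ fstar) := by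
  refine csInf_le ⟨0, ?_⟩ ⟨f₁, hf₁, f₂, hf₂, rfl, rfl⟩
  rintro t ⟨g₁, hg₁, g₂, hg₂, -, rfl⟩
  have h1 := avgLoss_nonneg_of_mainAssumption hM hg₁
  have h2 := avgLoss_nonneg_of_mainAssumption hM hg₂
  linarith

/-- For every representation of `h`, `(p - q)² ≤ 2p² + 2q²` followed by the Main Assumption bounds
the second moment. -/
lemma avgSqLoss_le_surrogateVar (hM : MainAssumption ℓ F S fstar B) {h : X × Y → ℝ}
    (hh : h ∈ lossDiffClass ℓ F) : avgSqLoss S h ≤ surrogateVar ℓ F S fstar B h := by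
  obtain ⟨f₁, hf₁, f₂, hf₂, rfl⟩ := hh
  refine le_csInf ⟨_, f₁, hf₁, f₂, hf₂, rfl, rfl⟩ ?_
  rintro t ⟨g₁, hg₁, g₂, hg₂, hg, rfl⟩
  rw [← hg]
  have h1 := hM.sq_le g₁ hg₁
  have h2 := hM.sq_le g₂ hg₂
  have h3 : avgSqLoss S (lossFun ℓ g₁ - lossFun ℓ g₂)
      ≤ 2 * avgSqLoss S (lossFun ℓ g₁ - lossFun ℓ fstar)
        + 2 * avgSqLoss S (lossFun ℓ g₂ - lossFun ℓ fstar) := by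
    unfold avgSqLoss
    have h4 : ∑ i, (lossFun ℓ g₁ - lossFun ℓ g₂) (S i) ^ 2
        ≤ 2 * ∑ i, (lossFun ℓ g₁ - lossFun ℓ fstar) (S i) ^ 2
          + 2 * ∑ i, (lossFun ℓ g₂ - lossFun ℓ fstar) (S i) ^ 2 := by
      rw [Finset.mul_sum, Finset.mul_sum, ← Finset.sum_add_distrib]
      refine Finset.sum_le_sum fun i _ => ?_
      simp only [Pi.sub_apply]
      nlinarith [sq_nonneg (lossFun ℓ g₁ (S i) - lossFun ℓ fstar (S i)
        + (lossFun ℓ g₂ (S i) - lossFun ℓ fstar (S i)))]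
    have h5 := mul_le_mul_of_nonneg_left h4 (by positivity : (0 : ℝ) ≤ 1 / (n : ℝ))
    linarith
  linarith

variable {L₀ : ℝ}

lemma abs_lossFun_sub_le (hL : ∀ f ∈ F, ∀ i, 0 ≤ lossFun ℓ f (S i) ∧ lossFun ℓ f (S i) ≤ L₀)
    {f₁ f₂ : X → ℝ} (hf₁ : f₁ ∈ F) (hf₂ : f₂ ∈ F) (i : Fin n) :
    |(lossFun ℓ f₁ - lossFun ℓ f₂) (S i)| ≤ L₀ := by
  have h1 := hL f₁ hf₁ i
  have h2 := hL f₂ hf₂ i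
  rw [Pi.sub_apply, abs_le]
  constructor <;> linarith [h1.1, h1.2, h2.1, h2.2]

lemma abs_avgLoss_le (hn : 0 < n) {h : X × Y → ℝ} (hL : ∀ i, |h (S i)| ≤ L₀) :
    |avgLoss S h| ≤ L₀ := by
  have hnp : (0 : ℝ) < n := by exact_mod_cast hn
  unfold avgLoss
  rw [abs_mul, abs_of_nonneg (by positivity : (0 : ℝ) ≤ 1 / (n : ℝ)), one_div,
    ← div_eq_inv_mul, div_le_iff₀ hnp]
  refine (Finset.abs_sum_le_sum_abs _ _).trans ((Finset.sum_le_sum fun i _ => hL i).trans ?_)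
  simp [mul_comm]

/-- Needed only to stop the peeling after finitely many shells; this constant does not enter the
final bound. -/
lemma surrogateVar_le_const (hn : 0 < n) (hM : MainAssumption ℓ F S fstar B)
    (hL : ∀ f ∈ F, ∀ i, 0 ≤ lossFun ℓ f (S i) ∧ lossFun ℓ f (S i) ≤ L₀) {h : X × Y → ℝ}
    (hh : h ∈ lossDiffClass ℓ F) : surrogateVar ℓ F S fstar B h ≤ 4 * (|B| * L₀) := by
  obtain ⟨f₁, hf₁, f₂, hf₂, rfl⟩ := hh
  refine (surrogateVar_le hM hf₁ hf₂).trans ?_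
  have aux : ∀ f ∈ F, B * avgLoss S (lossFun ℓ f - lossFun ℓ fstar) ≤ |B| * L₀ := by
    intro f hf
    refine (le_abs_self _).trans ?_
    rw [abs_mul]
    exact mul_le_mul_of_nonneg_left
      (abs_avgLoss_le hn (abs_lossFun_sub_le hL hf hM.mem)) (abs_nonneg _)
  have h1 := aux f₁ hf₁
  have h2 := aux f₂ hf₂
  linarith

/-- The localized deviation bound for the loss differences, for either sign. -/
lemma exists_bad_of_localClass (hM : MainAssumption ℓ F S fstar B)
    (hL : ∀ f ∈ F, ∀ i, 0 ≤ lossFun ℓ f (S i) ∧ lossFun ℓ f (S i) ≤ L₀)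
    {k : ℕ} (hk0 : 1 ≤ k) (hk : k ≤ n) {ε : ℝ} (hε : |ε| = 1) {ψ : ℝ → ℝ} {a : ℝ}
    (hψ : IsSubRoot ψ) (ha : IsFixedPointOf ψ a)
    (hE : ∀ r, a ≤ r → sliceMean univ k (fun W =>
      ⨆ h : localClass ℓ F S fstar B r, sliceDev univ k W (fun i => ε * h.1 (S i))) ≤ ψ r)
    (hE2 : ∀ r, a ≤ r → sliceMean univ k (fun W =>
      ⨆ h : localClass ℓ F S fstar B r, sliceDev univ k W (fun i => (h.1 ^ 2) (S i))) ≤ ψ r)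
    {K : ℝ} (hK : 1 < K) {x : ℝ} (hx : 0 < x) :
    ∃ Bad : Finset (Finset (Fin n)),
      (#Bad : ℝ) ≤ Real.exp (-x) * ((#(univ : Finset (Fin n))).choose k : ℝ) ∧
      ∀ W ∈ (univ : Finset (Fin n)).powersetCard k, W ∉ Bad → ∀ h ∈ lossDiffClass ℓ F,
        sliceDev univ k W (fun i => ε * h (S i)) ≤ (surrogateVar ℓ F S fstar B h
          + (65536 * K ^ 2 * a + radiusConst K L₀ * x / k)) / (2 * K) := by
  have hε2 : ε ^ 2 = 1 := by rw [← sq_abs, hε, one_pow]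
  have hn : 0 < n := by omega
  refine card_exists_localized_gt_le (v := fun h i => ε * h (S i))
    (τ := surrogateVar ℓ F S fstar B) hk0 (by simpa using hk) ?_
    (fun h hh => surrogateVar_le_const hn hM hL hh) ?_
    (h₀ := lossFun ℓ fstar - lossFun ℓ fstar) ⟨fstar, hM.mem, fstar, hM.mem, rfl⟩ ?_ ?_
    hψ ha hE ?_ hK hx
  · rintro _ ⟨f₁, hf₁, f₂, hf₂, rfl⟩ i
    rw [abs_mul, hε, one_mul]
    exact abs_lossFun_sub_le hL hf₁ hf₂ i
  · intro h hh
    refine le_trans (le_of_eq ?_) (avgSqLoss_le_surrogateVar hM hh)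
    simp only [avgSqLoss, mul_pow, hε2, one_mul, Finset.card_univ, Fintype.card_fin]
  · refine (surrogateVar_le hM hM.mem hM.mem).trans (le_of_eq ?_)
    simp [avgLoss]
  · intro i; simp
  · intro r hr
    refine le_trans (le_of_eq ?_) (hE2 r hr)
    simp only [mul_pow, hε2, one_mul, Pi.pow_apply]
    rfl

end LossClass

/-- The final arithmetic: from twice the localized bound to the stated one. -/
lemma two_mul_localized_le {K B P Q τ a c b x k : ℝ} (hK : 1 < K)
    (hτ : τ ≤ 2 * B * P + 2 * B * Q) (hac : a ≤ c) :
    2 * ((τ + (65536 * K ^ 2 * a + b * x / k)) / (2 * K))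
      ≤ 2 * B / K * (P + Q) + 65536 * K * c + b / K * x / k := by
  have hK0 : 0 < K := by linarith
  have e : 2 * ((τ + (65536 * K ^ 2 * a + b * x / k)) / (2 * K))
      = τ / K + 65536 * K * a + b / K * x / k := by
    rcases eq_or_ne k 0 with rfl | hk
    · simp only [div_zero, add_zero]; field_simp
    · field_simp
      ring
  have h1 : τ / K ≤ (2 * B * P + 2 * B * Q) / K := div_le_div_of_nonneg_right hτ hK0.le
  have h2 : (2 * B * P + 2 * B * Q) / K = 2 * B / K * (P + Q) := by ring
  have h3 : 65536 * K * a ≤ 65536 * K * c := mul_le_mul_of_nonneg_left hac (by positivity)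
  rw [e]
  linarith

end TLC

theorem mainTheorem7 (K : ℝ) (hK : 1 < K) :
    ∃ c₀ : ℝ, 0 < c₀ ∧ ∀ L₀ : ℝ, 2 * Real.sqrt 2 ≤ L₀ → ∃ c₁ : ℝ, 0 < c₁ ∧
      ∀ (u m : ℕ), 1 ≤ u → 1 ≤ m →
      ∀ (dim : ℕ) (X : Set (EuclideanSpace ℝ (Fin dim))) (Y : Set ℝ)
        (S : Fin (u + m) → X × Y) (ℓ : ℝ → Y → ℝ) (F : Set (X → ℝ)),
      (∀ f ∈ F, ∀ i, 0 ≤ TLC.lossFun ℓ f (S i) ∧ TLC.lossFun ℓ f (S i) ≤ L₀) →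
      ∀ (fstar : X → ℝ) (B : ℝ), TLC.MainAssumption ℓ F S fstar B →
      ∀ (ψu ψm : ℝ → ℝ) (ru rm : ℝ),
      TLC.IsSubRoot ψu → TLC.IsFixedPointOf ψu ru →
      TLC.IsSubRoot ψm → TLC.IsFixedPointOf ψm rm →
      (∀ r, ru ≤ r →
        max
          (TLC.expSup u m (TLC.localClass ℓ F S fstar B r) fun d h => TLC.testDev S d h)
          (TLC.expSup u m (TLC.localClass ℓ F S fstar B r) fun d h => TLC.testDev S d (h ^ 2))
        ≤ ψu r) →
      (∀ r, rm ≤ r →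
        max
          (TLC.expSup u m (TLC.localClass ℓ F S fstar B r) fun d h => -TLC.trainDev S d h)
          (TLC.expSup u m (TLC.localClass ℓ F S fstar B r) fun d h => TLC.trainDev S d (h ^ 2))
        ≤ ψm r) →
      ∀ x : ℝ, 0 < x →
        1 - Real.exp (-x) ≤ (TLC.drawLaw u m).real
          {d | ∀ h ∈ TLC.lossDiffClass ℓ F, ∀ f₁ ∈ F, ∀ f₂ ∈ F,
            h = TLC.lossFun ℓ f₁ - TLC.lossFun ℓ f₂ →
            TLC.testLoss S d h ≤ TLC.trainLoss S d h
              + 2 * B / K * (TLC.avgLoss S (TLC.lossFun ℓ f₁ - TLC.lossFun ℓ fstar)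
                  + TLC.avgLoss S (TLC.lossFun ℓ f₂ - TLC.lossFun ℓ fstar))
              + c₀ * (ru + rm) + c₁ * x / (min m u : ℝ)} := by
  have hK0 : 0 < K := by linarith
  refine ⟨65536 * K, by positivity, fun L₀ _ =>
    ⟨TLC.radiusConst K L₀ / K, div_pos (TLC.radiusConst_pos hK0 L₀) hK0, ?_⟩⟩
  intro u m hu hm dim X Y S ℓ F hL fstar B hM ψu ψm ru rm hψu hru hψm hrm hEu hEm x hx
  have hru0 : 0 ≤ ru := hru.1.1
  have hrm0 : 0 ≤ rm := hrm.1.1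
  have hvar0 : ∀ h ∈ TLC.lossDiffClass ℓ F, 0 ≤ TLC.surrogateVar ℓ F S fstar B h := fun h hh =>
    le_trans (mul_nonneg (by positivity) (Finset.sum_nonneg fun _ _ => sq_nonneg _))
      (TLC.avgSqLoss_le_surrogateVar hM hh)
  have hb := (TLC.radiusConst_pos hK0 L₀).le
  -- Only the smaller set is used: the test set with `h` if `u ≤ m`, the training set with `-h`
  -- otherwise.
  rcases le_total u m with hum | hmu
  · obtain ⟨Bad, hBad, hgood⟩ := TLC.exists_bad_of_localClass hM hL (k := u) hu (by omega)
      (ε := 1) abs_one hψu hru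
      (fun r hr => by
        have h1 := (le_max_left _ _).trans (hEu r hr)
        rw [TLC.expSup_testDev _ S fun h => h] at h1
        simpa only [one_mul] using h1)
      (fun r hr => by
        have h1 := (le_max_right _ _).trans (hEu r hr)
        rwa [TLC.expSup_testDev _ S fun h => h ^ 2] at h1) hK hx
    refine TLC.le_real_of_integral_eq TLC.integral_testSet (by omega) hBad ?_
    rintro d hd hdB h hh f₁ hf₁ f₂ hf₂ rfl
    have h1 := hgood _ (TLC.testSet_mem_powersetCard hd) hdB _ hh
    simp only [one_mul] at h1
    have h2 := TLC.testLoss_sub_trainLoss_le_of_test hu hum S _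
      (div_nonneg (add_nonneg (hvar0 _ hh) (by positivity)) (by positivity)) h1
    have h3 := TLC.two_mul_localized_le (b := TLC.radiusConst K L₀) (x := x) (k := (u : ℝ)) hK
      (TLC.surrogateVar_le hM hf₁ hf₂) (show ru ≤ ru + rm by linarith)
    rw [min_eq_right (by exact_mod_cast hum : (u : ℝ) ≤ m)]
    linarith
  · obtain ⟨Bad, hBad, hgood⟩ := TLC.exists_bad_of_localClass hM hL (k := m) hm (by omega)
      (ε := -1) (by simp) hψm hrm
      (fun r hr => by
        have h1 := (le_max_left _ _).trans (hEm r hr)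
        rw [TLC.expSup_neg_trainDev _ S fun h => h] at h1
        simpa only [neg_one_mul] using h1)
      (fun r hr => by
        have h1 := (le_max_right _ _).trans (hEm r hr)
        rwa [TLC.expSup_trainDev _ S fun h => h ^ 2] at h1) hK hx
    refine TLC.le_real_of_integral_eq TLC.integral_trainSet (by omega) hBad ?_
    rintro d hd hdB h hh f₁ hf₁ f₂ hf₂ rfl
    have h1 := hgood _ (TLC.trainSet_mem_powersetCard hd) hdB _ hh
    simp only [neg_one_mul] at h1
    have h2 := TLC.testLoss_sub_trainLoss_le_of_train hm hmu S _
      (div_nonneg (add_nonneg (hvar0 _ hh) (by positivity)) (by positivity)) h1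
    have h3 := TLC.two_mul_localized_le (b := TLC.radiusConst K L₀) (x := x) (k := (m : ℝ)) hK
      (TLC.surrogateVar_le hM hf₁ hf₂) (show rm ≤ ru + rm by linarith)
    rw [min_eq_left (by exact_mod_cast hmu : (m : ℝ) ≤ u)]
    linarith
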